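/- Let $n\ge 3$ and $m\ge 2$ be integers. Let $W_n$ be the wheel with $n$ rim vertices and one hub ($n+1$ vertices, $2n$ edges), and fix any vertex $r$ of $W_n$. Define graphs $G^{(i)}=G^{(i,m,n)}$, $i\ge 0$, as follows: $G^{(0)}=W_n$, and $G^{(i+1)}$ is obtained from $G^{(i)}$ by replacing every edge of $G^{(i)}$ by a path of length $m$ (inserting $m-1$ new vertices) and attaching to every vertex $v$ of $G^{(i)}$ a new copy of $W_n$, identifying the vertex $r$ of the copy with $v$ (the vertices just inserted into edges receive no copy at this step). Let $\tau(G)$ denote the number of spanning trees of $G$, let $|V^{(0)}|=1$, and let $|V^{(i+1)}|$ be the number of vertices of $G^{(i)}$. Put $$\zeta=\sqrt{6(m-1)n+(m-1)^2+n^2},\qquad \alpha_1=m-n,\qquad \alpha_2=m+n,$$ $$A=\frac{4(m-1)}{(\zeta-\alpha_1+1)(\zeta+\alpha_2-1)^2},$$ $$B=\frac{4n\ln m}{(\zeta-\alpha_2+1)^2}\Bigl(-\zeta+m^2(n-1)+m\bigl(\zeta+n(-\zeta+3n-7)+2\bigr)+n(3\zeta-5n+6)-1\Bigr),$$ $$D=4^n(\sqrt5+1)^{-2n}\cos(2\pi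 n),$$ $$C=\frac{(\zeta+\alpha_2-1)\bigl(\zeta+m(n-1)-n(\zeta+n+4)+1\bigr)}{-\zeta+\alpha_2-1}\,\ln\!\left[\left(\tfrac12(\sqrt5+1)\right)^{2n}-2+D\right].$$ Then the entropy of the fractal exists and equals $$\sigma=\lim_{i\to\infty}\frac{\ln\tau(G^{(i)})}{|V^{(i)}|}=A\,(B+C).$$ -/

import Mathlib

namespace WheelFractal

/-- The wheel `W_n` (`n + 1` vertices): the join of the `n`-cycle with a single hub vertex. -/
def wheel (n : ℕ) : SimpleGraph (Fin n ⊕ Unit) :=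
  (SimpleGraph.cycleGraph n ⊕g (⊥ : SimpleGraph Unit)) ⊔ completeBipartiteGraph (Fin n) Unit

/-- Vertices of the graph obtained by inserting `m - 1` new vertices into every edge of `G`. -/
abbrev SubdivVertex {V : Type} (m : ℕ) (G : SimpleGraph V) : Type :=
  V ⊕ (G.edgeSet × Fin (m - 1))

/-- The vertices in positions `0, 1, …, m` of the path of length `m` that replaces the edge `e`;
positions `0` and `m` are the two ends of `e` (in an arbitrarily chosen order). -/
noncomputable def subdivPath {V : Type} (m : ℕ) (G : SimpleGraph V) (e : G.edgeSet)
    (k : Fin (m + 1)) : SubdivVertex m G :=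
  if h0 : k.val = 0 then Sum.inl (Quot.out e.val).1
  else if hm : k.val = m then Sum.inl (Quot.out e.val).2
  else Sum.inr (e, ⟨k.val - 1, by omega⟩)

/-- Edge-Path-Transformation: every edge of `G` is replaced by a path of length `m`. -/
noncomputable def subdivide {V : Type} (m : ℕ) (G : SimpleGraph V) :
    SimpleGraph (SubdivVertex m G) :=
  ⨆ e : G.edgeSet, (SimpleGraph.pathGraph (m + 1)).map (subdivPath m G e)

/-- The vertex `w` in the copy of a graph with root `r` that is attached at `f v`: the root is
identified with `f v`, all other vertices are new. -/
def copyVertex {V X U : Type} [DecidableEq U] (f : V → X) (r : U) (v : V) (w : U) :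
    X ⊕ (V × {u : U // u ≠ r}) :=
  if h : w = r then Sum.inl (f v) else Sum.inr (v, ⟨w, h⟩)

/-- Graph-linking-Vertex: for every `v : V` a new copy of `K` is attached to the graph `G` by
identifying the vertex `r` of the copy with the vertex `f v` of `G`. -/
def attach {V X U : Type} [DecidableEq U] (G : SimpleGraph X) (f : V → X) (K : SimpleGraph U)
    (r : U) : SimpleGraph (X ⊕ (V × {u : U // u ≠ r})) :=
  G.map Sum.inl ⊔ ⨆ v : V, K.map (copyVertex f r v)

/-- The fractal `G^(i)`: `G^(0)` is the wheel `W_n`; `G^(i+1)` arises from `G^(i)` by replacing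
every edge of `G^(i)` by a path of length `m` and attaching a new copy of `W_n`, by its vertex `r`,
at every vertex of `G^(i)` (the vertices inserted in the edges get no copy at this step). -/
noncomputable def fractal (n m : ℕ) (r : Fin n ⊕ Unit) : ℕ → (V : Type) × SimpleGraph V
  | 0 => ⟨_, wheel n⟩
  | i + 1 => ⟨_, attach (subdivide m (fractal n m r i).2) Sum.inl (wheel n) r⟩

/-- `|V^(i)|`: `|V^(0)| = 1`, and `|V^(i+1)|` is the number of vertices of `G^(i)`. -/
noncomputable def vertexCount (n m : ℕ) (r : Fin n ⊕ Unit) : ℕ → ℕ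
  | 0 => 1
  | i + 1 => Nat.card (fractal n m r i).1

/-- The number `τ(G)` of spanning trees of a (finite) graph `G`. -/
noncomputable def numSpanningTrees {V : Type} (G : SimpleGraph V) : ℕ :=
  {T : SimpleGraph V | T ≤ G ∧ T.IsTree}.ncard

noncomputable def zeta (n m : ℝ) : ℝ := √(6 * (m - 1) * n + (m - 1) ^ 2 + n ^ 2)

noncomputable def alpha₁ (n m : ℝ) : ℝ := m - n

noncomputable def alpha₂ (n m : ℝ) : ℝ := m + n

noncomputable def coeffA (n m : ℝ) : ℝ :=
  4 * (m - 1) / ((zeta n m - alpha₁ n m + 1) * (zeta n m + alpha₂ n m - 1) ^ 2)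

noncomputable def coeffB (n m : ℝ) : ℝ :=
  4 * n * Real.log m / (zeta n m - alpha₂ n m + 1) ^ 2 *
    (-zeta n m + m ^ 2 * (n - 1) + m * (zeta n m + n * (-zeta n m + 3 * n - 7) + 2)
      + n * (3 * zeta n m - 5 * n + 6) - 1)

noncomputable def coeffD (n : ℕ) : ℝ :=
  4 ^ n * (√5 + 1) ^ (-(2 * n : ℤ)) * Real.cos (2 * Real.pi * n)

noncomputable def coeffC (n : ℕ) (m : ℝ) : ℝ :=
  1 / (-zeta n m + alpha₂ n m - 1) * (zeta n m + alpha₂ n m - 1) *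
    (zeta n m + m * (n - 1) - n * (zeta n m + n + 4) + 1) *
    Real.log ((1 / 2 * (√5 + 1)) ^ (2 * n) - 2 + coeffD n)

end WheelFractal

namespace WheelFractal

open SimpleGraph

/-! Both operations act simply on spanning trees. Gluing a copy of `K` at each of `|V|` vertices
creates no cycle through several pieces, so τ is multiplied by `τ(K) ^ |V|`
(`numSpanningTrees_attach`). A spanning tree of the subdivision of `G` is a spanning tree of `G`
together with one omitted path edge for each edge outside it, so τ is multiplied by `m ^ (|E| - |V|
+ 1)` (`numSpanningTrees_subdivide`). Both facts use trees as minimal connected graphs, so that only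
connectivity has to be analysed, mostly by collapsing maps.

For the wheel, orient a spanning tree towards the hub: each rim vertex points to the hub, its
successor or its predecessor. The admissible choices are the cyclic words avoiding one two-letter
pattern, minus two constant words. A transfer matrix with nonzero eigenvalues φ² and φ⁻², φ the
golden ratio, gives τ(W_n) = φ^(2n) + φ^(-2n) - 2 (`numSpanningTrees_wheel`); here D is φ^(-2n).

Let v, e be the vertex and edge counts, with indices shifted so that the wheel arises from a single
point (v = 1, e = 0). Then v' = (n+1)v + (m-1)e and e' = me + 2nv. The ratio e/v tends to the
positive root ρ of (m-1)ρ² + (n+1-m)ρ - 2n = 0, whose discriminant is ζ². The recursion for ln τ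
telescopes to a linear combination of the next v and e plus a term linear in the index
(`tendsto_log_div_vertices`). The shifted denominator brings in the limits n+1+(m-1)ρ and mρ+2n of
v'/v and e'/v. Rationalising with ζ² turns the result into A(B + C). -/

theorem reachable_of_forall_adj {V W : Type} {G : SimpleGraph V} {H : SimpleGraph W} (f : V → W)
    (hf : ∀ a b, G.Adj a b → H.Reachable (f a) (f b)) {a b : V} (h : G.Reachable a b) :
    H.Reachable (f a) (f b) := by
  obtain ⟨p⟩ := h
  induction p with
  | nil => exact Reachable.refl _
  | cons hadj _ ih => exact (hf _ _ hadj).trans ih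

theorem connected_of_forall_adj {V W : Type} {G : SimpleGraph V} {H : SimpleGraph W} (f : V → W)
    (hs : Function.Surjective f)
    (hf : ∀ a b, G.Adj a b → H.Reachable (f a) (f b)) (h : G.Connected) : H.Connected := by
  obtain ⟨v, hv⟩ := connected_iff_exists_forall_reachable G |>.1 h
  refine connected_iff_exists_forall_reachable H |>.2 ⟨f v, fun w => ?_⟩
  obtain ⟨u, rfl⟩ := hs w
  exact reachable_of_forall_adj f hf (hv u)

theorem reachable_of_eq_or_adj {W : Type} {H : SimpleGraph W} {a b : W} (h : a = b ∨ H.Adj a b) :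
    H.Reachable a b := by
  rcases h with rfl | h
  · exact Reachable.refl _
  · exact h.reachable

theorem comap_le_comap {V W : Type} (f : V → W) {G H : SimpleGraph W} (h : G ≤ H) :
    G.comap f ≤ H.comap f := fun _ _ hab => h hab

/-! ### Spanning trees and edges under attaching copies -/

section Attach

variable {V X U : Type} [DecidableEq U]

/-- Attaching a graph `K v` with root `r` at `f v`, for every `v`. -/
def attachFamily (G : SimpleGraph X) (f : V → X) (K : V → SimpleGraph U) (r : U) :
    SimpleGraph (X ⊕ (V × {u : U // u ≠ r})) :=
  G.map Sum.inl ⊔ ⨆ v : V, (K v).map (copyVertex f r v)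

theorem attach_eq_attachFamily (G : SimpleGraph X) (f : V → X) (K : SimpleGraph U) (r : U) :
    attach G f K r = attachFamily G f (fun _ => K) r := rfl

@[simp] theorem copyVertex_root (f : V → X) (r : U) (v : V) :
    copyVertex f r v r = Sum.inl (f v) := by simp [copyVertex]

theorem copyVertex_of_ne (f : V → X) (r : U) (v : V) {w : U} (h : w ≠ r) :
    copyVertex f r v w = Sum.inr (v, ⟨w, h⟩) := by simp [copyVertex, h]

theorem copyVertex_injective (f : V → X) (r : U) (v : V) :
    Function.Injective (copyVertex f r v) := by
  intro a b h
  unfold copyVertex at h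
  split_ifs at h <;> simp_all

theorem copyVertex_eq_inl (f : V → X) (r : U) (v : V) (w : U) (x : X) :
    copyVertex f r v w = Sum.inl x ↔ w = r ∧ f v = x := by
  unfold copyVertex
  split_ifs with h <;> simp [h]

theorem copyVertex_eq_inr (f : V → X) (r : U) (v : V) (w : U) (p : V × {u : U // u ≠ r}) :
    copyVertex f r v w = Sum.inr p ↔ v = p.1 ∧ w = p.2 := by
  unfold copyVertex
  split_ifs with h
  · simp only [false_iff, not_and]
    rintro - h'
    exact p.2.2 (h' ▸ h)
  · simp [Prod.ext_iff, Subtype.ext_iff]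

theorem copyVertex_eq_copyVertex (f : V → X) (r : U) {v v' : V} {w w' : U} (hw : w ≠ r)
    (h : copyVertex f r v' w' = copyVertex f r v w) : v' = v ∧ w' = w := by
  rw [copyVertex_of_ne f r v hw, copyVertex_eq_inr] at h
  exact h

theorem attachFamily_adj {G : SimpleGraph X} {f : V → X} {K : V → SimpleGraph U} {r : U}
    {a b : X ⊕ (V × {u : U // u ≠ r})} :
    (attachFamily G f K r).Adj a b ↔
      (∃ x y, G.Adj x y ∧ Sum.inl x = a ∧ Sum.inl y = b) ∨
      ∃ v x y, (K v).Adj x y ∧ copyVertex f r v x = a ∧ copyVertex f r v y = b := by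
  simp only [attachFamily, sup_adj, iSup_adj, map_adj']
  constructor
  · rintro (⟨-, h⟩ | ⟨v, -, h⟩)
    · exact Or.inl h
    · exact Or.inr ⟨v, h⟩
  · rintro (⟨x, y, h, rfl, rfl⟩ | ⟨v, x, y, h, rfl, rfl⟩)
    · exact Or.inl ⟨fun h' => h.ne (Sum.inl_injective h'), x, y, h, rfl, rfl⟩
    · exact Or.inr ⟨v, fun h' => h.ne (copyVertex_injective f r v h'), x, y, h, rfl, rfl⟩

theorem attachFamily_comap_inl (G : SimpleGraph X) (f : V → X) (K : V → SimpleGraph U) (r : U) :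
    (attachFamily G f K r).comap Sum.inl = G := by
  ext a b
  rw [comap_adj, attachFamily_adj]
  constructor
  · rintro (⟨x, y, h, hx, hy⟩ | ⟨v, x, y, h, hx, hy⟩)
    · cases hx; cases hy; exact h
    · rw [copyVertex_eq_inl] at hx hy
      exact absurd (hx.1.trans hy.1.symm) h.ne
  · exact fun h => Or.inl ⟨a, b, h, rfl, rfl⟩

/-- An edge of a copy has an end other than the root, and that end determines the copy; hence `f`
may be arbitrary. -/
theorem attachFamily_comap_copyVertex (G : SimpleGraph X) (f : V → X) (K : V → SimpleGraph U)
    (r : U) (v : V) : (attachFamily G f K r).comap (copyVertex f r v) = K v := by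
  ext a b
  rw [comap_adj, attachFamily_adj]
  constructor
  · rintro (⟨x, y, h, hx, hy⟩ | ⟨v', x, y, h, hx, hy⟩)
    · have hx' := (copyVertex_eq_inl f r v a x).1 hx.symm
      have hy' := (copyVertex_eq_inl f r v b y).1 hy.symm
      exact absurd (hx'.2.symm.trans hy'.2) h.ne
    · have hv : v' = v := by
        by_cases ha : a = r
        · by_cases hb : b = r
          · have := hx.trans ((congrArg _ (ha.trans hb.symm)).trans hy.symm)
            exact absurd (copyVertex_injective f r v' this) h.ne
          · exact (copyVertex_eq_copyVertex f r hb hy).1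
        · exact (copyVertex_eq_copyVertex f r ha hx).1
      subst hv
      rw [← copyVertex_injective f r v' hx, ← copyVertex_injective f r v' hy]
      exact h
  · exact fun h => Or.inr ⟨v, a, b, h, rfl, rfl⟩

theorem attachFamily_mono {G G' : SimpleGraph X} (f : V → X) {K K' : V → SimpleGraph U} (r : U)
    (hG : G ≤ G') (hK : ∀ v, K v ≤ K' v) : attachFamily G f K r ≤ attachFamily G' f K' r := by
  intro a b
  rw [attachFamily_adj, attachFamily_adj]
  rintro (⟨x, y, h, hx, hy⟩ | ⟨v, x, y, h, hx, hy⟩)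
  · exact Or.inl ⟨x, y, hG h, hx, hy⟩
  · exact Or.inr ⟨v, x, y, hK v h, hx, hy⟩

/-- Every edge lies in the base or in one copy, so a subgraph is recovered from its restrictions.
The copies may restrict differently, which is why the family version is needed. -/
theorem eq_attachFamily_of_le {G : SimpleGraph X} {f : V → X} {K : V → SimpleGraph U} {r : U}
    {T : SimpleGraph (X ⊕ (V × {u : U // u ≠ r}))} (hT : T ≤ attachFamily G f K r) :
    attachFamily (T.comap Sum.inl) f (fun v => T.comap (copyVertex f r v)) r = T := by
  ext a b
  rw [attachFamily_adj]
  constructor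
  · rintro (⟨x, y, h, rfl, rfl⟩ | ⟨v, x, y, h, rfl, rfl⟩) <;> exact h
  · intro h
    rcases attachFamily_adj.1 (hT h) with ⟨x, y, -, rfl, rfl⟩ | ⟨v, x, y, -, rfl, rfl⟩
    · exact Or.inl ⟨x, y, h, rfl, rfl⟩
    · exact Or.inr ⟨v, x, y, h, rfl, rfl⟩

theorem attachFamily_connected_iff {G : SimpleGraph X} {f : V → X} {K : V → SimpleGraph U}
    {r : U} : (attachFamily G f K r).Connected ↔ G.Connected ∧ ∀ v, (K v).Connected := by
  classical
  constructor
  · intro h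
    constructor
    -- Collapse every copy onto its attaching vertex.
    · refine connected_of_forall_adj (Sum.elim id fun p => f p.1) (fun x => ⟨Sum.inl x, rfl⟩) ?_ h
      intro a b hab
      apply reachable_of_eq_or_adj
      rcases attachFamily_adj.1 hab with ⟨x, y, h, rfl, rfl⟩ | ⟨v, x, y, h, rfl, rfl⟩
      · exact Or.inr h
      · left
        unfold copyVertex
        split_ifs <;> rfl
    · intro v
      -- Collapse everything outside the copy at `v` onto its root.
      let g : X ⊕ (V × {u : U // u ≠ r}) → U :=
        Sum.elim (fun _ => r) fun p => if p.1 = v then p.2.1 else r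
      have hg : ∀ w, g (copyVertex f r v w) = w := by
        intro w
        by_cases hw : w = r
        · subst hw; simp [g]
        · simp [g, copyVertex_of_ne f r v hw]
      have hg' : ∀ v' w, v' ≠ v → g (copyVertex f r v' w) = r := by
        intro v' w hv
        by_cases hw : w = r
        · subst hw; simp [g]
        · simp [g, copyVertex_of_ne f r v' hw, hv]
      refine connected_of_forall_adj g (fun w => ⟨_, hg w⟩) ?_ h
      intro a b hab
      apply reachable_of_eq_or_adj
      rcases attachFamily_adj.1 hab with ⟨x, y, h, rfl, rfl⟩ | ⟨v', x, y, h, rfl, rfl⟩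
      · exact Or.inl rfl
      · by_cases hv : v' = v
        · subst hv
          rw [hg, hg]
          exact Or.inr h
        · rw [hg' _ _ hv, hg' _ _ hv]
          exact Or.inl rfl
  · rintro ⟨hG, hK⟩
    obtain ⟨x₀⟩ := hG.nonempty
    have h1 : ∀ x, (attachFamily G f K r).Reachable (Sum.inl x₀) (Sum.inl x) := fun x =>
      reachable_of_forall_adj Sum.inl
        (fun a b h => (attachFamily_adj.2 (Or.inl ⟨a, b, h, rfl, rfl⟩)).reachable)
        (hG.preconnected x₀ x)
    refine connected_iff_exists_forall_reachable _ |>.2 ⟨Sum.inl x₀, ?_⟩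
    rintro (x | ⟨v, w, hw⟩)
    · exact h1 x
    · refine (h1 (f v)).trans ?_
      have := reachable_of_forall_adj (H := attachFamily G f K r) (copyVertex f r v)
        (fun a b h => (attachFamily_adj.2 (Or.inr ⟨v, a, b, h, rfl, rfl⟩)).reachable)
        ((hK v).preconnected r w)
      rwa [copyVertex_root, copyVertex_of_ne f r v hw] at this

theorem comap_inl_le {G : SimpleGraph X} {f : V → X} {K : V → SimpleGraph U} {r : U}
    {T : SimpleGraph (X ⊕ (V × {u : U // u ≠ r}))} (hT : T ≤ attachFamily G f K r) :
    T.comap Sum.inl ≤ G := by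
  have := comap_le_comap Sum.inl hT
  rwa [attachFamily_comap_inl] at this

theorem comap_copyVertex_le {G : SimpleGraph X} {f : V → X} {K : V → SimpleGraph U} {r : U}
    {T : SimpleGraph (X ⊕ (V × {u : U // u ≠ r}))} (hT : T ≤ attachFamily G f K r) (v : V) :
    T.comap (copyVertex f r v) ≤ K v := by
  have := comap_le_comap (copyVertex f r v) hT
  rwa [attachFamily_comap_copyVertex] at this

/-- Trees are the minimal connected graphs; connectivity and the order are both tested piece by
piece, so minimality is too. -/
theorem attachFamily_isTree_iff {G : SimpleGraph X} {f : V → X} {K : V → SimpleGraph U}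
    {r : U} : (attachFamily G f K r).IsTree ↔ G.IsTree ∧ ∀ v, (K v).IsTree := by
  classical
  simp only [isTree_iff_minimal_connected]
  constructor
  · intro h
    have hc := attachFamily_connected_iff.1 h.prop
    refine ⟨⟨hc.1, fun G' hG' hle => ?_⟩, fun v => ⟨hc.2 v, fun K' hK' hle => ?_⟩⟩
    · have := h.le_of_le (attachFamily_connected_iff.2 ⟨hG', hc.2⟩)
        (attachFamily_mono f r hle fun _ => le_rfl)
      have := comap_le_comap Sum.inl this
      rwa [attachFamily_comap_inl, attachFamily_comap_inl] at this
    · have := h.le_of_le (y := attachFamily G f (Function.update K v K') r)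
        (attachFamily_connected_iff.2 ⟨hc.1, fun v' => by
          by_cases hv : v' = v
          · subst hv; simpa using hK'
          · simpa [hv] using hc.2 v'⟩)
        (attachFamily_mono f r le_rfl fun v' => by
          by_cases hv : v' = v
          · subst hv; simpa using hle
          · simp [hv])
      have := comap_le_comap (copyVertex f r v) this
      simpa only [attachFamily_comap_copyVertex, Function.update_self] using this
  · rintro ⟨hG, hK⟩
    refine ⟨attachFamily_connected_iff.2 ⟨hG.prop, fun v => (hK v).prop⟩, fun T hT hle => ?_⟩
    change T ≤ attachFamily G f K r at hle
    rw [← eq_attachFamily_of_le hle] at hT ⊢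
    obtain ⟨h1, h2⟩ := attachFamily_connected_iff.1 hT
    refine attachFamily_mono f r (hG.le_of_le h1 (comap_inl_le hle)) fun v =>
      (hK v).le_of_le (h2 v) (comap_copyVertex_le hle v)

theorem numSpanningTrees_eq_natCard {V : Type} (G : SimpleGraph V) :
    numSpanningTrees G = Nat.card {T : SimpleGraph V // T ≤ G ∧ T.IsTree} := rfl

theorem isTree_comap_of_le {G : SimpleGraph X} {f : V → X} {K : V → SimpleGraph U} {r : U}
    {T : SimpleGraph (X ⊕ (V × {u : U // u ≠ r}))} (hT : T ≤ attachFamily G f K r)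
    (h : T.IsTree) : (T.comap Sum.inl).IsTree ∧ ∀ v, (T.comap (copyVertex f r v)).IsTree := by
  rwa [← eq_attachFamily_of_le hT, attachFamily_isTree_iff] at h

/-- A spanning tree of the attached graph is a spanning tree of the base together with one
of each copy. -/
def attachTreeEquiv (G : SimpleGraph X) (f : V → X) (K : SimpleGraph U) (r : U) :
    {T // T ≤ attach G f K r ∧ T.IsTree} ≃
      {T // T ≤ G ∧ T.IsTree} × (V → {T // T ≤ K ∧ T.IsTree}) where
  toFun T := ⟨⟨T.1.comap Sum.inl, comap_inl_le T.2.1, (isTree_comap_of_le T.2.1 T.2.2).1⟩,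
    fun v => ⟨T.1.comap (copyVertex f r v), comap_copyVertex_le T.2.1 v,
      (isTree_comap_of_le T.2.1 T.2.2).2 v⟩⟩
  invFun p := ⟨attachFamily p.1.1 f (fun v => (p.2 v).1) r,
    attachFamily_mono f r p.1.2.1 fun v => (p.2 v).2.1,
    attachFamily_isTree_iff.2 ⟨p.1.2.2, fun v => (p.2 v).2.2⟩⟩
  left_inv T := Subtype.ext (eq_attachFamily_of_le T.2.1)
  right_inv p := by
    refine Prod.ext (Subtype.ext ?_) (funext fun v => Subtype.ext ?_)
    · exact attachFamily_comap_inl _ _ _ _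
    · exact attachFamily_comap_copyVertex _ _ _ _ _

theorem numSpanningTrees_attach [Finite V] (G : SimpleGraph X) (f : V → X) (K : SimpleGraph U)
    (r : U) : numSpanningTrees (attach G f K r) =
      numSpanningTrees G * numSpanningTrees K ^ Nat.card V := by
  simp only [numSpanningTrees_eq_natCard]
  rw [Nat.card_congr (attachTreeEquiv G f K r), Nat.card_prod, Nat.card_fun]

theorem attach_connected {G : SimpleGraph X} (f : V → X) {K : SimpleGraph U} (r : U)
    (hG : G.Connected) (hK : K.Connected) : (attach G f K r).Connected :=
  attachFamily_connected_iff.2 ⟨hG, fun _ => hK⟩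

/-- The edges of the attached graph: those of the base and those of the copies. -/
def attachEdge (G : SimpleGraph X) (f : V → X) (K : SimpleGraph U) (r : U) :
    G.edgeSet ⊕ (V × K.edgeSet) → Sym2 (X ⊕ (V × {u : U // u ≠ r})) :=
  Sum.elim (fun e => e.1.map Sum.inl) fun p => p.2.1.map (copyVertex f r p.1)

theorem attachEdge_injective (G : SimpleGraph X) (f : V → X) (K : SimpleGraph U) (r : U) :
    Function.Injective (attachEdge G f K r) := by
  have hcopy : ∀ e ∈ K.edgeSet, ∃ w ∈ e, w ≠ r := by
    intro e he
    induction e with | _ a b =>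
    by_cases ha : a = r
    · refine ⟨b, by simp, fun hb => ?_⟩
      exact (K.mem_edgeSet.1 he).ne (ha.trans hb.symm)
    · exact ⟨a, by simp, ha⟩
  rintro (⟨e, he⟩ | ⟨v, e, he⟩) (⟨e', he'⟩ | ⟨v', e', he'⟩) h <;>
    simp only [attachEdge, Sum.elim_inl, Sum.elim_inr] at h
  · have := Sym2.map.injective Sum.inl_injective h
    subst this; rfl
  · obtain ⟨w, hw, hwr⟩ := hcopy e' he'
    have : copyVertex f r v' w ∈ e.map Sum.inl := h ▸ Sym2.mem_map.2 ⟨w, hw, rfl⟩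
    obtain ⟨x, -, hx⟩ := Sym2.mem_map.1 this
    exact absurd ((copyVertex_eq_inl _ _ _ _ _).1 hx.symm).1 hwr
  · obtain ⟨w, hw, hwr⟩ := hcopy e he
    have : copyVertex f r v w ∈ e'.map Sum.inl := h ▸ Sym2.mem_map.2 ⟨w, hw, rfl⟩
    obtain ⟨x, -, hx⟩ := Sym2.mem_map.1 this
    exact absurd ((copyVertex_eq_inl _ _ _ _ _).1 hx.symm).1 hwr
  · obtain ⟨w, hw, hwr⟩ := hcopy e he
    have : copyVertex f r v w ∈ e'.map (copyVertex f r v') := h ▸ Sym2.mem_map.2 ⟨w, hw, rfl⟩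
    obtain ⟨x, -, hx⟩ := Sym2.mem_map.1 this
    obtain ⟨rfl, -⟩ := copyVertex_eq_copyVertex f r hwr hx
    have := Sym2.map.injective (copyVertex_injective f r v') h
    subst this; rfl

theorem range_attachEdge (G : SimpleGraph X) (f : V → X) (K : SimpleGraph U) (r : U) :
    Set.range (attachEdge G f K r) = (attach G f K r).edgeSet := by
  ext e
  induction e with | _ a b =>
  rw [mem_edgeSet, attach_eq_attachFamily, attachFamily_adj]
  constructor
  · rintro ⟨⟨e, he⟩ | ⟨v, e, he⟩, h⟩ <;> induction e with | _ x y =>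
    simp only [attachEdge, Sum.elim_inl, Sum.elim_inr, Sym2.map_mk, Sym2.eq_iff] at h
    rw [mem_edgeSet] at he
    rcases h with h | h
    · first
      | exact Or.inl ⟨x, y, he, h⟩
      | exact Or.inr ⟨v, x, y, he, h⟩
    · first
      | exact Or.inl ⟨y, x, he.symm, h.symm⟩
      | exact Or.inr ⟨v, y, x, he.symm, h.symm⟩
  · rintro (⟨x, y, h, rfl, rfl⟩ | ⟨v, x, y, h, rfl, rfl⟩)
    · exact ⟨Sum.inl ⟨s(x, y), h⟩, rfl⟩
    · exact ⟨Sum.inr (v, ⟨s(x, y), h⟩), rfl⟩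

theorem card_edgeSet_attach [Finite V] [Finite X] [Finite U] (G : SimpleGraph X) (f : V → X)
    (K : SimpleGraph U) (r : U) : Nat.card (attach G f K r).edgeSet =
      Nat.card G.edgeSet + Nat.card V * Nat.card K.edgeSet := by
  rw [← range_attachEdge, Nat.card_range_of_injective (attachEdge_injective G f K r),
    Nat.card_sum, Nat.card_prod]

end Attach

end WheelFractal

namespace WheelFractal

open SimpleGraph

/-! ### Spanning trees and edges under subdivision -/

section Subdivide

variable {V : Type} {m : ℕ} {G : SimpleGraph V}

theorem eq_of_reachable_of_forall_adj {V W : Type} {G : SimpleGraph V} (f : V → W)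
    (hf : ∀ a b, G.Adj a b → f a = f b) {a b : V} (h : G.Reachable a b) : f a = f b := by
  obtain ⟨p⟩ := h
  induction p with
  | nil => rfl
  | cons hadj _ ih => exact (hf _ _ hadj).trans ih

theorem mk_out (e : G.edgeSet) : s((Quot.out e.val).1, (Quot.out e.val).2) = e.val :=
  Quot.out_eq e.val

theorem adj_out (e : G.edgeSet) : G.Adj (Quot.out e.val).1 (Quot.out e.val).2 := by
  rw [← mem_edgeSet, mk_out]
  exact e.2

theorem subdivPath_zero (e : G.edgeSet) (k : Fin (m + 1)) (hk : k.val = 0) :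
    subdivPath m G e k = Sum.inl (Quot.out e.val).1 := by
  simp [subdivPath, hk]

theorem subdivPath_last (e : G.edgeSet) (k : Fin (m + 1)) (h0 : k.val ≠ 0) (hk : k.val = m) :
    subdivPath m G e k = Sum.inl (Quot.out e.val).2 := by
  rw [subdivPath, dif_neg h0, dif_pos hk]

theorem subdivPath_mid (e : G.edgeSet) (k : Fin (m + 1)) (h0 : k.val ≠ 0) (hk : k.val ≠ m) :
    subdivPath m G e k = Sum.inr (e, ⟨k.val - 1, by omega⟩) := by
  rw [subdivPath, dif_neg h0, dif_neg hk]

theorem subdivPath_succ (e : G.edgeSet) (i : Fin (m - 1)) :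
    subdivPath m G e ⟨i.val + 1, by omega⟩ = Sum.inr (e, i) := by
  rw [subdivPath_mid _ _ (by simp) (by simp; omega)]
  simp

theorem subdivPath_injective (e : G.edgeSet) : Function.Injective (subdivPath m G e) := by
  intro a b h
  have hne := (adj_out e).ne
  apply Fin.ext
  unfold subdivPath at h
  split_ifs at h with h1 h2 h3 h4 h5 h6
  all_goals first
    | omega
    | exact absurd (Sum.inl_injective h) hne
    | exact absurd (Sum.inl_injective h).symm hne
    | (have := Sum.inr_injective h
       simp only [Prod.mk.injEq, Fin.mk.injEq, true_and] at this
       omega)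

theorem subdivPath_eq_inr {e e' : G.edgeSet} {k : Fin (m + 1)} {i : Fin (m - 1)}
    (h : subdivPath m G e k = Sum.inr (e', i)) : e = e' ∧ k.val = i.val + 1 := by
  unfold subdivPath at h
  split_ifs at h with h1 h2
  simp only [Sum.inr.injEq, Prod.mk.injEq] at h
  obtain ⟨h, rfl⟩ := h
  exact ⟨h, by simp; omega⟩

/-- The `j`-th edge of the path that replaces the edge `e`. -/
noncomputable def pathEdge (m : ℕ) (G : SimpleGraph V) (p : G.edgeSet × Fin m) :
    Sym2 (SubdivVertex m G) :=
  s(subdivPath m G p.1 p.2.castSucc, subdivPath m G p.1 p.2.succ)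

theorem pathEdge_injective (hm : 2 ≤ m) : Function.Injective (pathEdge m G) := by
  rintro ⟨e, j⟩ ⟨e', j'⟩ h
  -- Since `m ≥ 2`, each path edge contains an inserted vertex, which remembers `e`.
  have hmid : ∃ k i, subdivPath m G e k = Sum.inr (e, i) ∧
      subdivPath m G e k ∈ pathEdge m G (e, j) := by
    by_cases hj : j.val = 0
    · refine ⟨j.succ, _, subdivPath_mid e _ (by simp) (by simp; omega), by simp [pathEdge]⟩
    · refine ⟨j.castSucc, _, subdivPath_mid e _ (by simpa using hj) (by simp; omega),
        by simp [pathEdge]⟩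
  obtain ⟨k, i, hk, hmem⟩ := hmid
  rw [h, hk] at hmem
  have he : e' = e := by
    simp only [pathEdge, Sym2.mem_iff] at hmem
    rcases hmem with hmem | hmem <;> exact (subdivPath_eq_inr hmem.symm).1
  subst he
  have h' : s(j.castSucc, j.succ) = s(j'.castSucc, j'.succ) :=
    Sym2.map.injective (subdivPath_injective e') h
  rw [Sym2.eq_iff] at h'
  have : j = j' := by
    rcases h' with ⟨h1, -⟩ | ⟨h1, h2⟩
    · exact Fin.castSucc_injective _ h1
    · simp only [Fin.ext_iff, Fin.val_castSucc, Fin.val_succ] at h1 h2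
      omega
  rw [this]

theorem pathEdge_not_isDiag (p : G.edgeSet × Fin m) : ¬ (pathEdge m G p).IsDiag := by
  rw [pathEdge, Sym2.mk_isDiag_iff]
  intro h
  exact absurd (subdivPath_injective _ h) Fin.castSucc_lt_succ.ne

/-- The spanning subgraph of the subdivision formed by a set of path edges. -/
noncomputable def pathSubgraph (m : ℕ) (G : SimpleGraph V) (S : Set (G.edgeSet × Fin m)) :
    SimpleGraph (SubdivVertex m G) :=
  fromEdgeSet (pathEdge m G '' S)

theorem edgeSet_pathSubgraph (S : Set (G.edgeSet × Fin m)) :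
    (pathSubgraph m G S).edgeSet = pathEdge m G '' S := by
  rw [pathSubgraph, edgeSet_fromEdgeSet, sdiff_eq_left, Set.disjoint_left]
  rintro _ ⟨p, -, rfl⟩ h
  exact pathEdge_not_isDiag p h

theorem edgeSet_subdivide : (subdivide m G).edgeSet = Set.range (pathEdge m G) := by
  ext x
  induction x with | _ a b =>
  simp only [subdivide, mem_edgeSet, iSup_adj, map_adj', pathGraph_adj, Set.mem_range]
  constructor
  · rintro ⟨e, -, u, v, h | h, rfl, rfl⟩
    · refine ⟨(e, ⟨u, by omega⟩), ?_⟩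
      rw [pathEdge]
      congr 3
      exact Fin.ext (by simpa using h)
    · refine ⟨(e, ⟨v, by omega⟩), ?_⟩
      rw [pathEdge, Sym2.eq_swap]
      congr 3
      exact Fin.ext (by simpa using h)
  · rintro ⟨⟨e, j⟩, h⟩
    have hne := pathEdge_not_isDiag (e, j)
    rw [h, Sym2.mk_isDiag_iff] at hne
    refine ⟨e, hne, ?_⟩
    rw [pathEdge, Sym2.eq_iff] at h
    rcases h with h | h
    · exact ⟨_, _, Or.inl (by simp), h⟩
    · exact ⟨_, _, Or.inr (by simp), h.symm⟩

theorem subdivide_eq_pathSubgraph : subdivide m G = pathSubgraph m G Set.univ := by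
  rw [← edgeSet_inj, edgeSet_subdivide, edgeSet_pathSubgraph, Set.image_univ]

theorem pathSubgraph_le_iff (hm : 2 ≤ m) {S S' : Set (G.edgeSet × Fin m)} :
    pathSubgraph m G S ≤ pathSubgraph m G S' ↔ S ⊆ S' := by
  rw [← edgeSet_subset_edgeSet, edgeSet_pathSubgraph, edgeSet_pathSubgraph,
    Set.image_subset_image_iff (pathEdge_injective hm)]

theorem exists_eq_pathSubgraph {S : Set (G.edgeSet × Fin m)} {T : SimpleGraph (SubdivVertex m G)}
    (hT : T ≤ pathSubgraph m G S) : ∃ S', T = pathSubgraph m G S' := by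
  rw [← edgeSet_subset_edgeSet, edgeSet_pathSubgraph] at hT
  obtain ⟨S', -, h⟩ := Set.subset_image_iff.1 hT
  exact ⟨S', by rw [← edgeSet_inj, edgeSet_pathSubgraph, h]⟩

theorem pathSubgraph_adj {S : Set (G.edgeSet × Fin m)} {a b : SubdivVertex m G} :
    (pathSubgraph m G S).Adj a b ↔ ∃ p ∈ S, pathEdge m G p = s(a, b) := by
  rw [← mem_edgeSet, edgeSet_pathSubgraph, Set.mem_image]

/-- To check that adjacency implies a symmetric relation, it suffices to look at the path edges. -/
theorem forall_adj_pathSubgraph {S : Set (G.edgeSet × Fin m)}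
    {R : SubdivVertex m G → SubdivVertex m G → Prop} (hR : ∀ a b, R a b → R b a)
    (h : ∀ p ∈ S, R (subdivPath m G p.1 p.2.castSucc) (subdivPath m G p.1 p.2.succ)) (a b)
    (hab : (pathSubgraph m G S).Adj a b) : R a b := by
  obtain ⟨p, hp, h'⟩ := pathSubgraph_adj.1 hab
  rw [pathEdge, Sym2.eq_iff] at h'
  rcases h' with ⟨rfl, rfl⟩ | ⟨rfl, rfl⟩
  · exact h p hp
  · exact hR _ _ (h p hp)

/-- The edges of `G` all of whose path edges lie in `S`, as a graph. -/
def fullGraph (S : Set (G.edgeSet × Fin m)) : SimpleGraph V where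
  Adj a b := ∃ h : G.Adj a b, ∀ j, (⟨s(a, b), h⟩, j) ∈ S
  symm := ⟨fun a b ⟨h, hS⟩ => ⟨h.symm, fun j => by
    have := hS j
    convert this using 3
    exact Subtype.ext Sym2.eq_swap⟩⟩
  loopless := ⟨fun _ ⟨h, _⟩ => h.ne rfl⟩

theorem fullGraph_le (S : Set (G.edgeSet × Fin m)) : fullGraph S ≤ G := fun _ _ h => h.1

theorem mem_edgeSet_fullGraph {S : Set (G.edgeSet × Fin m)} (e : G.edgeSet) :
    e.val ∈ (fullGraph S).edgeSet ↔ ∀ j, (e, j) ∈ S := by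
  obtain ⟨e, he⟩ := e
  induction e with | _ a b =>
  rw [mem_edgeSet]
  exact ⟨fun ⟨_, h⟩ => h, fun h => ⟨he, h⟩⟩

/-- Two gaps `j < k` in one path would cut off the positions `j + 1, …, k` between them; `g` is the
indicator of that segment. -/
theorem eq_of_not_mem_of_connected {S : Set (G.edgeSet × Fin m)}
    (h : (pathSubgraph m G S).Connected) {e : G.edgeSet} {j k : Fin m} (hj : (e, j) ∉ S)
    (hk : (e, k) ∉ S) : ¬ j < k := by
  intro hjk
  rw [Fin.lt_def] at hjk
  let g : SubdivVertex m G → Prop :=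
    Sum.elim (fun _ => False) fun p => p.1 = e ∧ j.val ≤ p.2.val ∧ p.2.val < k.val
  have hg : ∀ e' (t : Fin (m + 1)), g (subdivPath m G e' t) =
      (e' = e ∧ j.val < t.val ∧ t.val ≤ k.val) := by
    intro e' t
    by_cases h0 : t.val = 0
    · rw [subdivPath_zero _ _ h0]
      simp [g, h0]
    by_cases h1 : t.val = m
    · rw [subdivPath_last _ _ h0 h1]
      simp [g, h1]
    · rw [subdivPath_mid _ _ h0 h1]
      simp only [g, Sum.elim_inr, eq_iff_iff]
      refine and_congr_right fun _ => ?_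
      omega
  have hadj : ∀ a b, (pathSubgraph m G S).Adj a b → g a = g b := by
    refine forall_adj_pathSubgraph (fun _ _ h => h.symm) ?_
    rintro ⟨e', t⟩ hp
    rw [hg, hg, eq_iff_iff]
    refine and_congr_right fun he => ?_
    subst he
    have h1 : t ≠ j := fun h => hj (h ▸ hp)
    have h2 : t ≠ k := fun h => hk (h ▸ hp)
    rw [Ne, Fin.ext_iff] at h1 h2
    simp only [Fin.val_castSucc, Fin.val_succ]
    omega
  have := eq_of_reachable_of_forall_adj g hadj
    (h.preconnected (Sum.inl (Quot.out e.val).1) (subdivPath m G e k.castSucc))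
  rw [hg, eq_iff_iff] at this
  exact this.2 ⟨rfl, hjk, le_rfl⟩

/-- Retract each path onto its ends: vertices before the first gap go to the first end, those after
it to the second. Only a path without gaps then contributes an edge, and it is an edge of `fullGraph
S`. -/
theorem fullGraph_connected {S : Set (G.edgeSet × Fin m)}
    (h : (pathSubgraph m G S).Connected) : (fullGraph S).Connected := by
  classical
  let ρ : SubdivVertex m G → V := Sum.elim id fun p =>
    -- Inserted vertex number `i` is at position `i + 1`, so the path edges before it are `0, …, i`.
    if ∃ j : Fin m, j.val ≤ p.2.val ∧ (p.1, j) ∉ S then (Quot.out p.1.val).2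
    else (Quot.out p.1.val).1
  have hρ : ∀ e (t : Fin (m + 1)), t.val ≠ m → ρ (subdivPath m G e t) =
      if ∃ j : Fin m, j.val < t.val ∧ (e, j) ∉ S then (Quot.out e.val).2
      else (Quot.out e.val).1 := by
    intro e t ht
    by_cases h0 : t.val = 0
    · rw [subdivPath_zero _ _ h0]
      simp [ρ, h0]
    · rw [subdivPath_mid _ _ h0 ht]
      simp only [ρ, Sum.elim_inr]
      congr 1
      simp only [eq_iff_iff]
      refine exists_congr fun j => and_congr_left fun _ => ?_
      omega
  refine connected_of_forall_adj ρ (fun v => ⟨Sum.inl v, rfl⟩) ?_ h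
  refine forall_adj_pathSubgraph (fun _ _ h => h.symm) ?_
  rintro ⟨e, t⟩ hp
  apply reachable_of_eq_or_adj
  have hstep : (∃ j : Fin m, j.val < t.val + 1 ∧ (e, j) ∉ S) ↔
      ∃ j : Fin m, j.val < t.val ∧ (e, j) ∉ S := by
    refine exists_congr fun j => and_congr_left fun hj => ?_
    have : j ≠ t := fun h => hj (h ▸ hp)
    rw [Ne, Fin.ext_iff] at this
    omega
  rw [hρ e t.castSucc (by simp; omega)]
  by_cases ht : t.val + 1 = m
  · rw [subdivPath_last e t.succ (by simp) (by simpa using ht)]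
    simp only [Fin.val_castSucc]
    split_ifs with hmiss
    · exact Or.inl rfl
    · right
      rw [← hstep] at hmiss
      push Not at hmiss
      change (fullGraph S).Adj _ (Quot.out e.val).2
      rw [← mem_edgeSet, mk_out, mem_edgeSet_fullGraph]
      exact fun j => hmiss j (by omega)
  · left
    rw [hρ e t.succ (by simpa using ht)]
    simp only [Fin.val_castSucc, Fin.val_succ, hstep]

theorem reachable_subdivPath {S : Set (G.edgeSet × Fin m)} {e : G.edgeSet} {a b : ℕ}
    (hab : a ≤ b) (hb : b < m + 1) (h : ∀ j : Fin m, a ≤ j.val → j.val < b → (e, j) ∈ S) :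
    (pathSubgraph m G S).Reachable (subdivPath m G e ⟨a, by omega⟩)
      (subdivPath m G e ⟨b, hb⟩) := by
  induction b, hab using Nat.le_induction with
  | base => exact Reachable.refl _
  | succ b hab ih =>
    refine (ih (by omega) fun j h1 h2 => h j h1 (by omega)).trans (Adj.reachable ?_)
    exact pathSubgraph_adj.2 ⟨(e, ⟨b, by omega⟩), h _ hab (by simp), rfl⟩

theorem pathSubgraph_connected_iff (hm : 2 ≤ m) {S : Set (G.edgeSet × Fin m)} :
    (pathSubgraph m G S).Connected ↔
      (∀ e j k, (e, j) ∉ S → (e, k) ∉ S → j = k) ∧ (fullGraph S).Connected := by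
  constructor
  · intro h
    refine ⟨fun e j k hj hk => ?_, fullGraph_connected h⟩
    exact le_antisymm (not_lt.1 (eq_of_not_mem_of_connected h hk hj))
      (not_lt.1 (eq_of_not_mem_of_connected h hj hk))
  · rintro ⟨h1, h2⟩
    obtain ⟨v₀⟩ := h2.nonempty
    have hinl : ∀ v, (pathSubgraph m G S).Reachable (Sum.inl v₀) (Sum.inl v) := fun v => by
      refine reachable_of_forall_adj Sum.inl ?_ (h2.preconnected v₀ v)
      rintro a b ⟨hab, hS⟩
      have := reachable_subdivPath (S := S) (e := ⟨s(a, b), hab⟩) (Nat.zero_le m)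
        (Nat.lt_succ_self m) fun j _ _ => hS j
      rw [subdivPath_zero _ _ rfl, subdivPath_last _ _ (by simp; omega) rfl] at this
      have hout := mk_out (⟨s(a, b), hab⟩ : G.edgeSet)
      rw [Sym2.eq_iff] at hout
      rcases hout with ⟨ha, hb⟩ | ⟨ha, hb⟩
      · rwa [ha, hb] at this
      · rw [ha, hb] at this
        exact this.symm
    refine connected_iff_exists_forall_reachable _ |>.2 ⟨Sum.inl v₀, ?_⟩
    rintro (v | ⟨e, i⟩)
    · exact hinl v
    · rw [← subdivPath_succ]
      -- If the only possible gap lies before the vertex, walk on to the far end; otherwise walk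
      -- back to the near end.
      by_cases hmiss : ∃ j : Fin m, j.val ≤ i.val ∧ (e, j) ∉ S
      · obtain ⟨j, hj, hjS⟩ := hmiss
        have := reachable_subdivPath (S := S) (e := e) (a := i.val + 1) (b := m) (by omega)
          (by omega) fun k hk _ => by
            by_contra hkS
            have := h1 e j k hjS hkS
            subst this
            omega
        rw [subdivPath_last _ ⟨m, _⟩ (by simp; omega) rfl] at this
        exact (hinl _).trans this.symm
      · push Not at hmiss
        have := reachable_subdivPath (S := S) (e := e) (Nat.zero_le (i.val + 1))
          (by omega) fun k _ hk => hmiss k (by omega)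
        rw [subdivPath_zero _ ⟨0, _⟩ rfl] at this
        exact (hinl _).trans this

theorem subdivide_connected (hm : 2 ≤ m) (hG : G.Connected) : (subdivide m G).Connected := by
  rw [subdivide_eq_pathSubgraph, pathSubgraph_connected_iff hm]
  exact ⟨fun _ _ _ h => absurd (Set.mem_univ _) h,
    hG.mono fun a b h => ⟨h, fun _ => Set.mem_univ _⟩⟩

/-- All path edges except, for each edge `e` of `G` outside `T`, the one chosen by `c`. -/
def omitChosen (T : SimpleGraph V) (c : {e : G.edgeSet // e.val ∉ T.edgeSet} → Fin m) :
    Set (G.edgeSet × Fin m) :=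
  {p | ∀ h : p.1.val ∉ T.edgeSet, p.2 ≠ c ⟨p.1, h⟩}

theorem fullGraph_omitChosen {T : SimpleGraph V} (hT : T ≤ G)
    (c : {e : G.edgeSet // e.val ∉ T.edgeSet} → Fin m) : fullGraph (omitChosen T c) = T := by
  ext a b
  constructor
  · intro hab
    rw [← mem_edgeSet]
    by_contra h
    have := (mem_edgeSet_fullGraph (S := omitChosen T c) ⟨s(a, b), hab.1⟩).1 hab
    exact this (c ⟨_, h⟩) h rfl
  · exact fun hab => ⟨hT hab, fun j h => absurd hab h⟩

theorem omitChosen_connected (hm : 2 ≤ m) {T : SimpleGraph V} (hT : T ≤ G) (hc : T.Connected)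
    (c : {e : G.edgeSet // e.val ∉ T.edgeSet} → Fin m) :
    (pathSubgraph m G (omitChosen T c)).Connected := by
  rw [pathSubgraph_connected_iff hm, fullGraph_omitChosen hT]
  refine ⟨fun e j k hj hk => ?_, hc⟩
  simp only [omitChosen, Set.mem_ofPred_eq, not_forall, not_not] at hj hk
  obtain ⟨_, rfl⟩ := hj
  obtain ⟨_, rfl⟩ := hk
  rfl

theorem omitChosen_isTree (hm : 2 ≤ m) {T : SimpleGraph V} (hT : T ≤ G) (ht : T.IsTree)
    (c : {e : G.edgeSet // e.val ∉ T.edgeSet} → Fin m) :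
    (pathSubgraph m G (omitChosen T c)).IsTree := by
  rw [isTree_iff_minimal_connected] at ht ⊢
  refine ⟨omitChosen_connected hm hT ht.prop c, fun T' hT' hle => ?_⟩
  obtain ⟨S', rfl⟩ := exists_eq_pathSubgraph hle
  have hle' := (pathSubgraph_le_iff hm).1 hle
  obtain ⟨h1, h2⟩ := (pathSubgraph_connected_iff hm).1 hT'
  -- Minimality of `T` forces all paths over edges of `T` to stay complete; over the other edges the
  -- chosen gap already uses up the one gap allowed.
  have hfull : T ≤ fullGraph S' := ht.le_of_le h2 fun a b ⟨hab, hS⟩ => by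
    rw [← fullGraph_omitChosen hT c]
    exact ⟨hab, fun j => hle' (hS j)⟩
  refine (pathSubgraph_le_iff hm).2 ?_
  rintro ⟨e, j⟩ hp
  by_cases he : e.val ∈ T.edgeSet
  · exact (mem_edgeSet_fullGraph e).1 (edgeSet_mono hfull he) j
  · by_contra hj
    have : (e, c ⟨e, he⟩) ∉ S' := fun h => hle' h he rfl
    exact hp he (h1 e _ _ hj this)

/-- A spanning tree of `G` and a choice of an omitted path edge for each edge outside of it give a
spanning tree of the subdivision. -/
noncomputable def subdivideTree (hm : 2 ≤ m) (G : SimpleGraph V)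
    (x : (T : {T : SimpleGraph V // T ≤ G ∧ T.IsTree}) ×
      ({e : G.edgeSet // e.val ∉ T.val.edgeSet} → Fin m)) :
    {T : SimpleGraph (SubdivVertex m G) // T ≤ subdivide m G ∧ T.IsTree} :=
  ⟨pathSubgraph m G (omitChosen x.1.1 x.2), by
    rw [subdivide_eq_pathSubgraph, pathSubgraph_le_iff hm]
    exact Set.subset_univ _, omitChosen_isTree hm x.1.2.1 x.1.2.2 x.2⟩

theorem subdivideTree_bijective (hm : 2 ≤ m) (G : SimpleGraph V) :
    Function.Bijective (subdivideTree hm G) := by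
  constructor
  · rintro ⟨⟨T, hT, ht⟩, c⟩ ⟨⟨T', hT', ht'⟩, c'⟩ h
    have h' : pathSubgraph m G (omitChosen T c) = pathSubgraph m G (omitChosen T' c') :=
      congrArg Subtype.val h
    have hS : omitChosen T c = omitChosen T' c' :=
      subset_antisymm ((pathSubgraph_le_iff hm).1 h'.le) ((pathSubgraph_le_iff hm).1 h'.ge)
    have hTT : T = T' := by
      rw [← fullGraph_omitChosen hT c, hS, fullGraph_omitChosen]
      exact hT'
    subst hTT
    congr 1
    funext ⟨e, he⟩
    by_contra hne
    have : (e, c ⟨e, he⟩) ∈ omitChosen T c := hS ▸ fun _ => hne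
    exact this he rfl
  · rintro ⟨T, hT, ht⟩
    rw [subdivide_eq_pathSubgraph] at hT
    obtain ⟨S, rfl⟩ := exists_eq_pathSubgraph hT
    rw [isTree_iff_minimal_connected] at ht
    -- It suffices to take any spanning tree of the full graph: the resulting connected subgraph
    -- lies below the given tree, hence equals it by minimality.
    obtain ⟨T', hT', ht'⟩ := (fullGraph_connected ht.prop).exists_isTree_le
    have hc : ∀ e : {e : G.edgeSet // e.val ∉ T'.edgeSet},
        ∃ j : Fin m, ∀ k, k ≠ j → (e.val, k) ∈ S := by
      intro e
      by_cases hj : ∃ j, (e.val, j) ∉ S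
      · obtain ⟨j, hj⟩ := hj
        refine ⟨j, fun k hk => ?_⟩
        by_contra hkS
        exact hk (((pathSubgraph_connected_iff hm).1 ht.prop).1 e k j hkS hj)
      · push Not at hj
        exact ⟨⟨0, by omega⟩, fun k _ => hj k⟩
    choose c hc using hc
    have hTG := hT'.trans (fullGraph_le S)
    refine ⟨⟨⟨T', hTG, ht'⟩, c⟩, Subtype.ext ?_⟩
    have hle : pathSubgraph m G (omitChosen T' c) ≤ pathSubgraph m G S := by
      rw [pathSubgraph_le_iff hm]
      rintro ⟨e, j⟩ hp
      by_cases he : e.val ∈ T'.edgeSet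
      · exact (mem_edgeSet_fullGraph e).1 (edgeSet_mono hT' he) j
      · exact hc ⟨e, he⟩ j (hp he)
    exact le_antisymm hle (ht.le_of_le (omitChosen_connected hm hTG ht'.connected c) hle)

/-- Each spanning tree leaves out `|E| - (|V| - 1)` edges, each with `m` choices. Without spanning
trees both sides vanish, so the truncated subtraction is harmless. -/
theorem numSpanningTrees_subdivide [Finite V] (hm : 2 ≤ m) (G : SimpleGraph V) :
    numSpanningTrees (subdivide m G) =
      m ^ (Nat.card G.edgeSet + 1 - Nat.card V) * numSpanningTrees G := by
  classical
  simp only [numSpanningTrees_eq_natCard]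
  have : Fintype {T : SimpleGraph V // T ≤ G ∧ T.IsTree} := Fintype.ofFinite _
  rw [← Nat.card_congr (Equiv.ofBijective _ (subdivideTree_bijective hm G)), Nat.card_sigma,
    Finset.sum_congr rfl (g := fun _ => m ^ (Nat.card G.edgeSet + 1 - Nat.card V)),
    Finset.sum_const, smul_eq_mul, mul_comm, Finset.card_univ,
    Nat.card_eq_fintype_card (α := {T : SimpleGraph V // T ≤ G ∧ T.IsTree})]
  rintro ⟨T, hT, ht⟩ -
  change Nat.card ({e : G.edgeSet // e.val ∉ T.edgeSet} → Fin m) = _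
  rw [Nat.card_fun, Nat.card_fin]
  congr 1
  have hcard := (isTree_iff_connected_and_card.1 ht).2
  have h1 := Nat.card_congr (Equiv.sumCompl fun e : G.edgeSet => e.val ∈ T.edgeSet)
  rw [Nat.card_sum] at h1
  have h2 : Nat.card {e : G.edgeSet // e.val ∈ T.edgeSet} = Nat.card T.edgeSet :=
    Nat.card_congr (Equiv.subtypeSubtypeEquivSubtype fun h => edgeSet_mono hT h)
  omega

theorem card_edgeSet_subdivide (hm : 2 ≤ m) (G : SimpleGraph V) :
    Nat.card (subdivide m G).edgeSet = Nat.card G.edgeSet * m := by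
  rw [edgeSet_subdivide, Nat.card_range_of_injective (pathEdge_injective hm), Nat.card_prod,
    Nat.card_fin]

end Subdivide

end WheelFractal

namespace WheelFractal

open SimpleGraph

/-! ### Spanning trees as parent functions towards a root -/

section Parent

variable {W : Type}

/-- The graph on `W` and an extra root in which every `w` is joined to `p w`. -/
def parentGraph (p : W → W ⊕ Unit) : SimpleGraph (W ⊕ Unit) :=
  fromEdgeSet (Set.range fun w => s(Sum.inl w, p w))

/-- No infinite chain of parents: following `p` always leads to the root. -/
def ReachesRoot (p : W → W ⊕ Unit) : Prop :=
  WellFounded fun u w => p w = Sum.inl u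

theorem ReachesRoot.ne {p : W → W ⊕ Unit} (h : ReachesRoot p) (w : W) : p w ≠ Sum.inl w :=
  fun hw => h.asymmetric _ _ hw hw

theorem ReachesRoot.adj {p : W → W ⊕ Unit} (h : ReachesRoot p) (w : W) :
    (parentGraph p).Adj (Sum.inl w) (p w) :=
  (fromEdgeSet_adj _).2 ⟨⟨w, rfl⟩, (h.ne w).symm⟩

theorem ReachesRoot.connected {p : W → W ⊕ Unit} (h : ReachesRoot p) :
    (parentGraph p).Connected := by
  refine connected_iff_exists_forall_reachable _ |>.2 ⟨Sum.inr (), ?_⟩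
  rintro (w | ⟨⟩)
  · induction w using h.induction with | _ w ih =>
    refine Reachable.trans ?_ (h.adj w).symm.reachable
    rcases hw : p w with u | ⟨⟩
    · exact ih u hw
    · exact Reachable.refl _
  · exact Reachable.refl _

theorem ReachesRoot.isTree [Finite W] {p : W → W ⊕ Unit} (h : ReachesRoot p) :
    (parentGraph p).IsTree := by
  refine isTree_iff_connected_and_card.2 ⟨h.connected, ?_⟩
  have h1 := h.connected.card_vert_le_card_edgeSet_add_one
  have h2 : Nat.card (parentGraph p).edgeSet ≤ Nat.card W := by
    rw [parentGraph, edgeSet_fromEdgeSet]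
    refine (Nat.card_mono (Set.finite_range _) Set.sdiff_subset).trans ?_
    exact Finite.card_range_le _
  have h3 : Nat.card (W ⊕ Unit) = Nat.card W + 1 := by simp [Nat.card_sum]
  omega

/-- Induct outwards from the root. If the edge from `v` to `p v` came from `q` in the opposite
direction, the induction hypothesis at `p v` would make `v` and `p v` parents of each other under
`p`. -/
theorem ReachesRoot.eq_of_parentGraph_eq {p q : W → W ⊕ Unit} (hp : ReachesRoot p)
    (h : parentGraph p = parentGraph q) : p = q := by
  funext v
  induction v using hp.induction with | _ v ih =>
  have hadj := hp.adj v
  rw [h, parentGraph, fromEdgeSet_adj] at hadj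
  obtain ⟨⟨u, hu⟩, -⟩ := hadj
  rw [Sym2.eq_iff] at hu
  rcases hu with ⟨h1, h2⟩ | ⟨h1, h2⟩
  · cases h1; exact h2.symm
  · exact absurd ((ih u h1.symm).trans h2) fun h3 => hp.asymmetric _ _ h1.symm h3

theorem exists_parent {T : SimpleGraph (W ⊕ Unit)} (hT : T.Connected) (w : W) :
    ∃ u, T.Adj (Sum.inl w) u ∧ T.dist u (Sum.inr ()) < T.dist (Sum.inl w) (Sum.inr ()) := by
  obtain ⟨q, hq⟩ := (hT.preconnected (Sum.inl w) (Sum.inr ())).exists_walk_length_eq_dist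
  cases q with
  | cons hadj q' =>
    refine ⟨_, hadj, ?_⟩
    rw [← hq, Walk.length_cons]
    exact Nat.lt_succ_of_le (dist_le q')

/-- Spanning trees correspond to choices of a parent for every non-root vertex. -/
theorem numSpanningTrees_eq_card_parent [Finite W] (G : SimpleGraph (W ⊕ Unit)) :
    numSpanningTrees G =
      Nat.card {p : W → W ⊕ Unit // (∀ w, G.Adj (Sum.inl w) (p w)) ∧ ReachesRoot p} := by
  rw [numSpanningTrees_eq_natCard]
  have hle : ∀ {T : SimpleGraph (W ⊕ Unit)} {p : W → W ⊕ Unit},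
      (∀ w, T.Adj (Sum.inl w) (p w)) → parentGraph p ≤ T := by
    intro T p hp a b hab
    obtain ⟨⟨w, hw⟩, -⟩ := (fromEdgeSet_adj _).1 hab
    have := hp w
    rw [← mem_edgeSet] at this ⊢
    exact hw ▸ this
  symm
  refine Nat.card_congr (Equiv.ofBijective
    (fun p => ⟨parentGraph p.1, hle p.2.1, p.2.2.isTree⟩) ⟨?_, ?_⟩)
  · intro p q h
    exact Subtype.ext (p.2.2.eq_of_parentGraph_eq (congrArg Subtype.val h))
  · rintro ⟨T, hT, ht⟩
    choose p hp hlt using exists_parent ht.connected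
    have hr : ReachesRoot p := by
      refine Subrelation.wf ?_
        (InvImage.wf (fun w => T.dist (Sum.inl w) (Sum.inr ())) Nat.lt_wfRel.wf)
      intro u w huw
      have := hlt w
      rwa [huw] at this
    refine ⟨⟨p, fun w => hT (hp w), hr⟩, Subtype.ext ?_⟩
    exact le_antisymm (hle hp)
      ((isTree_iff_minimal_connected.1 ht).le_of_le hr.connected (hle hp))

end Parent

/-! ### Transfer matrix for cyclic words -/

section CyclicWords

open Matrix

variable {A R : Type} [Fintype A] [DecidableEq A] [CommSemiring R]

/-- Sum over walks from `a` to `b` with intermediate letters `g`: `cons` lists the sources of the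
steps and `snoc` their targets. -/
theorem matrix_pow_succ_apply (M : Matrix A A R) (k : ℕ) (a b : A) :
    (M ^ (k + 1)) a b =
      ∑ g : Fin k → A, ∏ i : Fin (k + 1),
        M (Fin.cons (α := fun _ => A) a g i) (Fin.snoc (α := fun _ => A) g b i) := by
  induction k generalizing a with
  | zero => simp [Fin.snoc]
  | succ k ih =>
    rw [pow_succ', mul_apply, ← (Fin.consEquiv fun _ : Fin (k + 1) => A).sum_comp,
      Fintype.sum_prod_type]
    refine Finset.sum_congr rfl fun c _ => ?_
    rw [ih, Finset.mul_sum]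
    refine Finset.sum_congr rfl fun g _ => ?_
    change _ = ∏ i : Fin (k + 2), M (Fin.cons (α := fun _ => A) a
      (Fin.cons (α := fun _ => A) c g) i)
      (Fin.snoc (α := fun _ => A) (Fin.cons (α := fun _ => A) c g) b i)
    rw [Fin.prod_univ_succ (n := k + 1), ← Fin.cons_snoc_eq_snoc_cons]
    simp only [Fin.cons_zero, Fin.cons_succ]

theorem trace_pow_succ (M : Matrix A A R) (k : ℕ) :
    (M ^ (k + 1)).trace = ∑ f : Fin (k + 1) → A, ∏ i, M (f i) (f (i + 1)) := by
  rw [← (Fin.consEquiv fun _ : Fin (k + 1) => A).sum_comp, Fintype.sum_prod_type, trace]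
  refine Finset.sum_congr rfl fun a _ => ?_
  rw [diag_apply, matrix_pow_succ_apply]
  refine Finset.sum_congr rfl fun g _ => Finset.prod_congr rfl fun i _ => ?_
  congr 1
  induction i using Fin.lastCases with
  | last => simp
  | cast i => simp [Fin.consEquiv_apply, Fin.coeSucc_eq_succ]

theorem card_cyclic_words (r : A → A → Prop) [DecidableRel r] (k : ℕ) :
    Fintype.card {f : Fin (k + 1) → A // ∀ i, r (f i) (f (i + 1))} =
      ((Matrix.of fun a b => if r a b then 1 else 0 : Matrix A A ℕ) ^ (k + 1)).trace := by
  rw [trace_pow_succ, Fintype.card_subtype, Finset.card_filter]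
  refine Finset.sum_congr rfl fun f _ => ?_
  simp only [of_apply, Finset.prod_boole, Finset.mem_univ, true_imp_iff]

end CyclicWords

/-! ### Spanning trees and edges of the wheel -/

section Wheel

theorem wheel_adj_inl_inl {n : ℕ} (i j : Fin n) :
    (wheel n).Adj (Sum.inl i) (Sum.inl j) ↔ (cycleGraph n).Adj i j := by
  simp [wheel]

theorem wheel_adj_inl_inr {n : ℕ} (i : Fin n) (u : Unit) :
    (wheel n).Adj (Sum.inl i) (Sum.inr u) := by
  simp [wheel]

theorem wheel_connected (n : ℕ) : (wheel n).Connected := by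
  refine connected_iff_exists_forall_reachable _ |>.2 ⟨Sum.inr (), ?_⟩
  rintro (i | ⟨⟩)
  · exact (wheel_adj_inl_inr i ()).symm.reachable
  · exact Reachable.refl _

variable {k : ℕ}

theorem fin_add_one_ne_sub_one (i : Fin (k + 3)) : i + 1 ≠ i - 1 := by
  intro h
  have h2 : (1 : Fin (k + 3)) + 1 = 0 := by
    have : i + 1 - i + 1 = i - 1 - i + 1 := by rw [h]
    simpa using this
  have := congrArg Fin.val h2
  rw [Fin.val_add] at this
  simp [Nat.mod_eq_of_lt (show 2 < k + 3 by omega)] at this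

open Fin.CommRing in
theorem fin_forall_of_add_one {P : Fin (k + 3) → Prop} (h : ∀ i, P i → P (i + 1))
    {i : Fin (k + 3)} (hi : P i) (j : Fin (k + 3)) : P j := by
  have : ∀ t : ℕ, P (i + (t : Fin (k + 3))) := by
    intro t
    induction t with
    | zero => simpa using hi
    | succ t ih =>
      rw [Nat.cast_succ, ← add_assoc]
      exact h _ ih
  have := this (j - i).val
  rwa [Fin.cast_val_eq_self, add_sub_cancel] at this

theorem fin_forall_of_sub_one {P : Fin (k + 3) → Prop} (h : ∀ i, P i → P (i - 1))
    {i : Fin (k + 3)} (hi : P i) (j : Fin (k + 3)) : P j := by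
  have := fin_forall_of_add_one (P := fun i => P (-i))
    (fun i hi => by rw [neg_add']; exact h _ hi) (i := -i) (by simpa using hi) (-j)
  simpa using this

/-- The parent of rim vertex `i` encoded by a letter: the hub, the successor, or the
predecessor. -/
def wheelParent (f : Fin (k + 3) → Fin 3) (i : Fin (k + 3)) : Fin (k + 3) ⊕ Unit :=
  ![Sum.inr (), Sum.inl (i + 1), Sum.inl (i - 1)] (f i)

/-- Two consecutive rim vertices are not each other's parents. -/
abbrev Compatible (a b : Fin 3) : Prop := ¬ (a = 1 ∧ b = 2)

theorem wheelParent_eq_inl {f : Fin (k + 3) → Fin 3} {i j : Fin (k + 3)} :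
    wheelParent f i = Sum.inl j ↔ (f i = 1 ∧ i + 1 = j) ∨ (f i = 2 ∧ i - 1 = j) := by
  unfold wheelParent
  generalize f i = x
  fin_cases x <;> simp

/-- A chain of parents that misses the hub either turns back, giving a 2-cycle, or runs around the
whole rim in one direction. -/
theorem reachesRoot_wheelParent_iff (f : Fin (k + 3) → Fin 3) :
    ReachesRoot (wheelParent f) ↔
      (∀ i, Compatible (f i) (f (i + 1))) ∧ ¬ (∀ i, f i = 1) ∧ ¬ ∀ i, f i = 2 := by
  constructor
  · intro h
    refine ⟨fun i ⟨h1, h2⟩ => ?_, fun hc => ?_, fun hc => ?_⟩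
    · exact h.asymmetric i (i + 1) (wheelParent_eq_inl.2 (Or.inr ⟨h2, by simp⟩))
        (wheelParent_eq_inl.2 (Or.inl ⟨h1, rfl⟩))
    · obtain ⟨i, -, hi⟩ := h.has_min Set.univ ⟨0, trivial⟩
      exact hi (i + 1) trivial (wheelParent_eq_inl.2 (Or.inl ⟨hc i, rfl⟩))
    · obtain ⟨i, -, hi⟩ := h.has_min Set.univ ⟨0, trivial⟩
      exact hi (i - 1) trivial (wheelParent_eq_inl.2 (Or.inr ⟨hc i, rfl⟩))
  · rintro ⟨hcomp, h1, h2⟩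
    have hcases : ∀ x : Fin 3, x = 0 ∨ x = 1 ∨ x = 2 := by decide
    have hacc0 : ∀ i, f i = 0 → Acc (fun u w => wheelParent f w = Sum.inl u) i := by
      intro i hi
      refine ⟨_, fun j hj => ?_⟩
      rw [wheelParent_eq_inl, hi] at hj
      simp at hj
    have hacc1 : ∀ i, f i = 1 → Acc (fun u w => wheelParent f w = Sum.inl u) (i + 1) →
        Acc (fun u w => wheelParent f w = Sum.inl u) i := by
      intro i hi h
      refine ⟨_, fun j hj => ?_⟩
      rw [wheelParent_eq_inl, hi] at hj
      rcases hj with ⟨-, rfl⟩ | ⟨hj, -⟩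
      · exact h
      · exact absurd hj (by decide)
    have hacc2 : ∀ i, f i = 2 → Acc (fun u w => wheelParent f w = Sum.inl u) (i - 1) →
        Acc (fun u w => wheelParent f w = Sum.inl u) i := by
      intro i hi h
      refine ⟨_, fun j hj => ?_⟩
      rw [wheelParent_eq_inl, hi] at hj
      rcases hj with ⟨hj, -⟩ | ⟨-, rfl⟩
      · exact absurd hj (by decide)
      · exact h
    refine ⟨fun i => by_contra fun hi => ?_⟩
    rcases hcases (f i) with h | h | h
    · exact hi (hacc0 i h)
    -- A vertex with letter 1 and no access to the hub passes both properties to its successor,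
    -- hence to the entire rim.
    · refine h1 fun j => (fin_forall_of_add_one
        (P := fun i => f i = 1 ∧ ¬ Acc (fun u w => wheelParent f w = Sum.inl u) i)
        ?_ ⟨h, hi⟩ j).1
      rintro i ⟨hi1, hi2⟩
      have hn : ¬ Acc (fun u w => wheelParent f w = Sum.inl u) (i + 1) :=
        fun h => hi2 (hacc1 i hi1 h)
      refine ⟨?_, hn⟩
      rcases hcases (f (i + 1)) with h | h | h
      · exact absurd (hacc0 _ h) hn
      · exact h
      · exact absurd ⟨hi1, h⟩ (hcomp i)
    · refine h2 fun j => (fin_forall_of_sub_one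
        (P := fun i => f i = 2 ∧ ¬ Acc (fun u w => wheelParent f w = Sum.inl u) i)
        ?_ ⟨h, hi⟩ j).1
      rintro i ⟨hi1, hi2⟩
      have hn : ¬ Acc (fun u w => wheelParent f w = Sum.inl u) (i - 1) :=
        fun h => hi2 (hacc2 i hi1 h)
      refine ⟨?_, hn⟩
      rcases hcases (f (i - 1)) with h | h | h
      · exact absurd (hacc0 _ h) hn
      · exact absurd ⟨h, by rwa [sub_add_cancel]⟩ (hcomp (i - 1))
      · exact h

theorem wheelParent_adj (f : Fin (k + 3) → Fin 3) (i : Fin (k + 3)) :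
    (wheel (k + 3)).Adj (Sum.inl i) (wheelParent f i) := by
  unfold wheelParent
  generalize f i = x
  fin_cases x
  · exact wheel_adj_inl_inr i ()
  · exact (wheel_adj_inl_inl _ _).2 (cycleGraph_adj.2 (Or.inr (by simp)))
  · exact (wheel_adj_inl_inl _ _).2 (cycleGraph_adj.2 (Or.inl (by simp)))

theorem wheelParent_injective : Function.Injective (wheelParent (k := k)) := by
  intro f g h
  funext i
  have := congrFun h i
  unfold wheelParent at this
  generalize f i = x at *
  generalize g i = y at *
  have h1 := fin_add_one_ne_sub_one i
  fin_cases x <;> fin_cases y <;> simp_all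

theorem exists_wheelParent_eq {p : Fin (k + 3) → Fin (k + 3) ⊕ Unit}
    (hp : ∀ i, (wheel (k + 3)).Adj (Sum.inl i) (p i)) : ∃ f, wheelParent f = p := by
  have : ∀ i, ∃ x : Fin 3, (![Sum.inr (), Sum.inl (i + 1), Sum.inl (i - 1)] :
      Fin 3 → Fin (k + 3) ⊕ Unit) x = p i := by
    intro i
    have := hp i
    rcases hpi : p i with j | ⟨⟩
    · rw [hpi, wheel_adj_inl_inl, cycleGraph_adj] at this
      rcases this with h | h
      · exact ⟨2, congrArg Sum.inl (by rw [← h]; simp)⟩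
      · exact ⟨1, congrArg Sum.inl (by rw [← h]; simp)⟩
    · exact ⟨0, rfl⟩
  choose f hf using this
  exact ⟨f, funext hf⟩

theorem numSpanningTrees_wheel_add_two (k : ℕ) :
    numSpanningTrees (wheel (k + 3)) + 2 =
      ((Matrix.of fun a b => if Compatible a b then 1 else 0 : Matrix (Fin 3) (Fin 3) ℕ)
        ^ (k + 3)).trace := by
  classical
  rw [← card_cyclic_words, numSpanningTrees_eq_card_parent]
  have e : {f : Fin (k + 3) → Fin 3 // (∀ i, Compatible (f i) (f (i + 1))) ∧
      ¬ (∀ i, f i = 1) ∧ ¬ ∀ i, f i = 2} ≃ {p : Fin (k + 3) → Fin (k + 3) ⊕ Unit //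
        (∀ i, (wheel (k + 3)).Adj (Sum.inl i) (p i)) ∧ ReachesRoot p} :=
    Equiv.ofBijective (fun f => ⟨wheelParent f.1, wheelParent_adj f.1,
        (reachesRoot_wheelParent_iff f.1).2 f.2⟩)
      ⟨fun f g h => Subtype.ext (wheelParent_injective (congrArg Subtype.val h)), by
        rintro ⟨p, hp, hr⟩
        obtain ⟨f, rfl⟩ := exists_wheelParent_eq hp
        exact ⟨⟨f, (reachesRoot_wheelParent_iff f).1 hr⟩, rfl⟩⟩
  rw [← Nat.card_congr e, Nat.card_eq_fintype_card, Fintype.card_subtype, Fintype.card_subtype]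
  -- The 2 counts the constant words 1 and 2, which are compatible but run around the rim forever.
  have hne : (fun _ => 1 : Fin (k + 3) → Fin 3) ≠ fun _ => 2 := fun h =>
    absurd (congrFun h 0) (by decide)
  refine (congrArg _ (Finset.card_pair hne).symm).trans ?_
  rw [← Finset.card_union_of_disjoint]
  · congr 1
    ext f
    simp only [Finset.mem_union, Finset.mem_filter, Finset.mem_univ, true_and,
      Finset.mem_insert, Finset.mem_singleton, funext_iff]
    constructor
    · rintro (h | h | h)
      · exact h.1
      · exact fun i ⟨_, hi⟩ => absurd ((h _).symm.trans hi) (by decide)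
      · exact fun i ⟨hi, _⟩ => absurd ((h _).symm.trans hi) (by decide)
    · intro h
      tauto
  · rw [Finset.disjoint_left]
    intro f hf hf'
    simp only [Finset.mem_filter, Finset.mem_univ, true_and, Finset.mem_insert,
      Finset.mem_singleton, funext_iff] at hf hf'
    tauto

theorem trace_compatible_pow (n : ℕ) :
    (((Matrix.of fun a b => if Compatible a b then 1 else 0 : Matrix (Fin 3) (Fin 3) ℕ)
        ^ (n + 1)).trace : ℝ) = ((1 / 2) * (√5 + 1)) ^ (2 * (n + 1))
          + ((1 / 2) * (√5 - 1)) ^ (2 * (n + 1)) := by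
  set M := (Matrix.of fun a b => if Compatible a b then 1 else 0 : Matrix (Fin 3) (Fin 3) ℕ)
    with hM
  have h5 : √5 ^ 2 = 5 := Real.sq_sqrt (by norm_num)
  have hrec : ∀ j, (M ^ (j + 3)).trace + (M ^ (j + 1)).trace = 3 * (M ^ (j + 2)).trace := by
    intro j
    -- Cayley–Hamilton: the characteristic polynomial is x³ - 3x² + x, whose nonzero roots are the
    -- squares of (√5 ± 1)/2.
    have h3 : M ^ 3 + M = 3 • M ^ 2 := by rw [hM]; decide
    have : M ^ (j + 3) + M ^ (j + 1) = 3 • M ^ (j + 2) := by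
      rw [pow_add, pow_add _ j 1, pow_add _ j 2, pow_one, ← mul_add, h3, mul_smul_comm]
    rw [← Matrix.trace_add, this, Matrix.trace_smul, smul_eq_mul]
  have hroot : ∀ x : ℝ, x ^ 4 + 1 = 3 * x ^ 2 → ∀ j : ℕ,
      x ^ (2 * (j + 3)) + x ^ (2 * (j + 1)) = 3 * x ^ (2 * (j + 2)) := by
    intro x hx j
    linear_combination x ^ (2 * j + 2) * hx
  have hx : ((1 / 2) * (√5 + 1)) ^ 4 + 1 = 3 * ((1 / 2) * (√5 + 1)) ^ 2 := by
    linear_combination ((√5 ^ 2 + 4 * √5 + 6 - 12 + 5) / 16) * h5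
  have hy : ((1 / 2) * (√5 - 1)) ^ 4 + 1 = 3 * ((1 / 2) * (√5 - 1)) ^ 2 := by
    linear_combination ((√5 ^ 2 - 4 * √5 + 6 - 12 + 5) / 16) * h5
  induction n using Nat.twoStepInduction with
  | zero =>
    have : (M ^ 1).trace = 3 := by rw [hM]; decide
    rw [zero_add, this]
    linear_combination -(1 / 2) * h5
  | one =>
    have : (M ^ 2).trace = 7 := by rw [hM]; decide
    rw [one_add_one_eq_two, this]
    linear_combination -(1 / 8) * (√5 ^ 2 + 5 + 6) * h5
  | more j ih1 ih2 =>
    have h := hrec j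
    rify at h
    have e1 := hroot _ hx j
    have e2 := hroot _ hy j
    linear_combination h - e1 - e2 - ih1 + 3 * ih2

/-- The spokes and the rim edges of the wheel. -/
def wheelEdge : Fin (k + 3) ⊕ Fin (k + 3) → Sym2 (Fin (k + 3) ⊕ Unit) :=
  Sum.elim (fun i => s(Sum.inl i, Sum.inr ())) fun i => s(Sum.inl i, Sum.inl (i + 1))

theorem wheelEdge_injective : Function.Injective (wheelEdge (k := k)) := by
  rintro (i | i) (j | j) h <;> simp [wheelEdge] at h
  · rw [h]
  · rcases h with h | ⟨h1, h2⟩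
    · rw [h]
    · exact absurd (h2.trans (by rw [h1]; simp)) (fin_add_one_ne_sub_one i)

theorem range_wheelEdge : Set.range (wheelEdge (k := k)) = (wheel (k + 3)).edgeSet := by
  ext e
  constructor
  · rintro ⟨i | i, rfl⟩
    · exact wheel_adj_inl_inr i ()
    · exact (wheel_adj_inl_inl _ _).2 (cycleGraph_adj.2 (Or.inr (by simp)))
  · induction e with | _ a b =>
    intro h
    rw [mem_edgeSet] at h
    rcases a with i | ⟨⟩ <;> rcases b with j | ⟨⟩
    · rw [wheel_adj_inl_inl, cycleGraph_adj] at h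
      rcases h with h | h
      · exact ⟨Sum.inr j, by simp [wheelEdge, ← h]⟩
      · exact ⟨Sum.inr i, by simp [wheelEdge, ← h]⟩
    · exact ⟨Sum.inl i, rfl⟩
    · exact ⟨Sum.inl j, Sym2.eq_swap⟩
    · exact absurd rfl h.ne

theorem card_edgeSet_wheel (n : ℕ) (hn : 3 ≤ n) : Nat.card (wheel n).edgeSet = 2 * n := by
  obtain ⟨k, rfl⟩ := Nat.exists_eq_add_of_le' hn
  rw [← range_wheelEdge, Nat.card_range_of_injective wheelEdge_injective, Nat.card_sum,
    Nat.card_fin, two_mul]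

theorem numSpanningTrees_wheel (n : ℕ) (hn : 3 ≤ n) :
    (numSpanningTrees (wheel n) : ℝ) =
      (1 / 2 * (√5 + 1)) ^ (2 * n) - 2 + coeffD n := by
  obtain ⟨k, rfl⟩ := Nat.exists_eq_add_of_le' hn
  have h := numSpanningTrees_wheel_add_two k
  rify at h
  rw [trace_compatible_pow (k + 2)] at h
  have hD : coeffD (k + 3) = ((1 / 2) * (√5 - 1)) ^ (2 * (k + 3)) := by
    have h5 : √5 ^ 2 = 5 := Real.sq_sqrt (by norm_num)
    have hcos : Real.cos (2 * Real.pi * (k + 3 : ℕ)) = 1 := by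
      rw [mul_comm]
      exact Real.cos_nat_mul_two_pi _
    have hne : √5 + 1 ≠ 0 := by positivity
    rw [coeffD, hcos, mul_one, zpow_neg, ← div_eq_mul_inv, div_eq_iff (by positivity)]
    have : (√5 + 1) ^ (2 * (k + 3 : ℕ) : ℤ) = (√5 + 1) ^ (2 * (k + 3)) := by
      exact_mod_cast zpow_natCast (√5 + 1) (2 * (k + 3))
    rw [this, ← mul_pow, show 1 / 2 * (√5 - 1) * (√5 + 1) = 2 by linear_combination h5 / 2,
      pow_mul]
    norm_num
  rw [hD]
  linear_combination h

end Wheel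

end WheelFractal

namespace WheelFractal

open SimpleGraph Filter

/-! ### Asymptotics of the linear recurrences -/

section Asymptotics

variable {n m : ℝ}

theorem zeta_sq (hn : 0 < n) (hm : 1 < m) :
    zeta n m ^ 2 = 6 * (m - 1) * n + (m - 1) ^ 2 + n ^ 2 := by
  have : 0 < m - 1 := by linarith
  exact Real.sq_sqrt (by positivity)

theorem lt_zeta (hn : 0 < n) (hm : 1 < m) : m - 1 + n < zeta n m := by
  have : 0 < m - 1 := by linarith
  refine Real.lt_sqrt_of_sq_lt ?_
  nlinarith [mul_pos this hn]

theorem zeta_lt (hn : 0 < n) (hm : 1 < m) : zeta n m < m - 1 + 3 * n := by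
  have : 0 < m - 1 := by linarith
  refine (Real.sqrt_lt' (by positivity)).2 ?_
  nlinarith [mul_pos this hn]

/-- The limit of the number of edges per vertex. -/
noncomputable def edgeDensity (n m : ℝ) : ℝ := (m - 1 - n + zeta n m) / (2 * (m - 1))

/-- Denominators are cleared with (ζ - α₁ + 1)(ζ + α₁ - 1) = 8(m-1)n and (ζ + α₂ - 1)(ζ - α₂ + 1) =
4(m-1)n; what remains is polynomial modulo the formula for ζ². -/
theorem coeffA_mul_coeffB (hn : 0 < n) (hm : 1 < m) :
    coeffA n m * coeffB n m = Real.log m *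
      ((2 * (n + 1 + (m - 1) * edgeDensity n m) - (m * edgeDensity n m + 2 * n)) / (m - 1) -
        (m * edgeDensity n m + 2 * n - (n + 1 + (m - 1) * edgeDensity n m)) / n) := by
  have hu : 0 < m - 1 := by linarith
  have hz := zeta_sq hn hm
  have h1 := lt_zeta hn hm
  unfold coeffA coeffB edgeDensity alpha₁ alpha₂
  generalize zeta n m = z at *
  have e1 : (z - (m - n) + 1)⁻¹ = (z + (m - 1) - n) / (8 * (m - 1) * n) := by
    have : z - (m - n) + 1 ≠ 0 := by linarith
    field_simp
    linear_combination -hz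
  have e2 : ((z + (m + n) - 1) ^ 2)⁻¹ * ((z - (m + n) + 1) ^ 2)⁻¹ =
      1 / (16 * (m - 1) ^ 2 * n ^ 2) := by
    rw [← mul_inv, ← mul_pow, one_div]
    congr 1
    rw [show (z + (m + n) - 1) * (z - (m + n) + 1) = 4 * (m - 1) * n by linear_combination hz]
    ring
  calc _ = 4 * (m - 1) * (z - (m - n) + 1)⁻¹ * (4 * n * Real.log m) *
        (((z + (m + n) - 1) ^ 2)⁻¹ * ((z - (m + n) + 1) ^ 2)⁻¹) *
        (-z + m ^ 2 * (n - 1) + m * (z + n * (-z + 3 * n - 7) + 2)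
          + n * (3 * z - 5 * n + 6) - 1) := by
        rw [div_eq_mul_inv, mul_inv, div_eq_mul_inv]; ring
    _ = _ := by
        rw [e1, e2]
        field_simp
        linear_combination 32 * Real.log m * (-1 + m - m * n + 3 * n) * hz

theorem coeffA_mul_coeffC_factor (hn : 0 < n) (hm : 1 < m) :
    coeffA n m * (1 / (-zeta n m + alpha₂ n m - 1) * (zeta n m + alpha₂ n m - 1) *
      (zeta n m + m * (n - 1) - n * (zeta n m + n + 4) + 1)) =
      (m * edgeDensity n m + 2 * n - (n + 1 + (m - 1) * edgeDensity n m)) / n := by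
  have hu : 0 < m - 1 := by linarith
  have hz := zeta_sq hn hm
  have h1 := lt_zeta hn hm
  unfold coeffA edgeDensity alpha₁ alpha₂
  generalize zeta n m = z at *
  have e1 : (z - (m - n) + 1)⁻¹ = (z + (m - 1) - n) / (8 * (m - 1) * n) := by
    have : z - (m - n) + 1 ≠ 0 := by linarith
    field_simp
    linear_combination -hz
  have hne : z + (m + n) - 1 ≠ 0 := by linarith
  have e2 : ((z + (m + n) - 1) ^ 2)⁻¹ * ((-z + (m + n) - 1)⁻¹ * (z + (m + n) - 1)) =
      -1 / (4 * (m - 1) * n) := by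
    have hne' : -z + (m + n) - 1 ≠ 0 := by linarith
    field_simp
    linear_combination -hz
  calc _ = 4 * (m - 1) * (z - (m - n) + 1)⁻¹ *
        (((z + (m + n) - 1) ^ 2)⁻¹ * ((-z + (m + n) - 1)⁻¹ * (z + (m + n) - 1))) *
        (z + m * (n - 1) - n * (z + n + 4) + 1) := by
        rw [div_eq_mul_inv, mul_inv, one_div]; ring
    _ = _ := by
        rw [e1, e2]
        field_simp
        linear_combination (-2 * (1 - n)) * hz

variable {v e : ℕ → ℝ}

theorem pow_le_vertices (hn : 0 < n) (hm : 1 < m) (v0 : v 0 = 1) (e0 : e 0 = 0)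
    (hv : ∀ i, v (i + 1) = (n + 1) * v i + (m - 1) * e i)
    (he : ∀ i, e (i + 1) = m * e i + 2 * n * v i) (i : ℕ) :
    (n + 1) ^ i ≤ v i ∧ 0 ≤ e i := by
  have hu : 0 < m - 1 := by linarith
  induction i with
  | zero => simp [v0, e0]
  | succ i ih =>
    have hvi : 0 ≤ v i := le_trans (by positivity) ih.1
    have hei := ih.2
    constructor
    · rw [hv, pow_succ']
      have := mul_le_mul_of_nonneg_left ih.1 (show 0 ≤ n + 1 by linarith)
      have := mul_nonneg hu.le ih.2
      linarith
    · rw [he]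
      positivity

/-- The combination e - ρv is multiplied at each step by the smaller eigenvalue m - ρ(m-1), of
absolute value at most n, while v grows at least by the factor n + 1. So the error of e/v contracts
by n/(n+1). -/
theorem tendsto_edges_div_vertices (hn : 1 ≤ n) (hm : 1 < m) (v0 : v 0 = 1) (e0 : e 0 = 0)
    (hv : ∀ i, v (i + 1) = (n + 1) * v i + (m - 1) * e i)
    (he : ∀ i, e (i + 1) = m * e i + 2 * n * v i) :
    Tendsto (fun i => e i / v i) atTop (nhds (edgeDensity n m)) := by
  have hn0 : 0 < n := by linarith
  have hu : 0 < m - 1 := by linarith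
  have hz := zeta_sq hn0 hm
  have h1 := lt_zeta hn0 hm
  have h2 := zeta_lt hn0 hm
  set ρ := edgeDensity n m with hρ
  have hfix : (m - 1) * ρ ^ 2 + (n + 1 - m) * ρ - 2 * n = 0 := by
    rw [hρ, edgeDensity]
    field_simp
    linear_combination hz
  have hμ : |m - ρ * (m - 1)| ≤ n := by
    have : ρ * (m - 1) = (m - 1 - n + zeta n m) / 2 := by
      rw [hρ, edgeDensity]
      field_simp
    rw [this, abs_le]
    constructor <;> linarith
  have hb : ∀ i, |e i / v i - ρ| ≤ (n / (n + 1)) ^ i * |ρ| := by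
    intro i
    induction i with
    | zero => simp [e0]
    | succ i ih =>
      obtain ⟨hvi, hei⟩ := pow_le_vertices hn0 hm v0 e0 hv he i
      have hvi0 : 0 < v i := lt_of_lt_of_le (by positivity) hvi
      have hw : (n + 1) * v i ≤ v (i + 1) := by
        rw [hv]
        have := mul_nonneg hu.le hei
        linarith
      have hw0 : 0 < v (i + 1) := lt_of_lt_of_le (by positivity) hw
      have hstep : e (i + 1) / v (i + 1) - ρ =
          (m - ρ * (m - 1)) * (v i / v (i + 1)) * (e i / v i - ρ) := by
        field_simp
        rw [he, hv]
        linear_combination -v i * hfix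
      have hq : v i / v (i + 1) ≤ 1 / (n + 1) := by
        rw [div_le_div_iff₀ hw0 (by positivity)]
        linarith
      rw [hstep, abs_mul, abs_mul, abs_of_pos (div_pos hvi0 hw0)]
      calc _ ≤ n * (1 / (n + 1)) * ((n / (n + 1)) ^ i * |ρ|) := by gcongr
        _ = _ := by rw [pow_succ]; ring
  rw [tendsto_iff_norm_sub_tendsto_zero]
  refine squeeze_zero (fun _ => norm_nonneg _) hb ?_
  have := (tendsto_pow_atTop_nhds_zero_of_lt_one (r := n / (n + 1)) (by positivity)
    ((div_lt_one (by linarith)).2 (by linarith))).mul_const |ρ|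
  simpa using this

theorem tendsto_log_div_vertices {ℓ : ℕ → ℝ} {L w : ℝ} (hn : 1 ≤ n) (hm : 1 < m)
    (v0 : v 0 = 1) (e0 : e 0 = 0)
    (hv : ∀ i, v (i + 1) = (n + 1) * v i + (m - 1) * e i)
    (he : ∀ i, e (i + 1) = m * e i + 2 * n * v i) (ℓ0 : ℓ 0 = w)
    (hℓ : ∀ i, ℓ (i + 1) = ℓ i + (e (i + 1) - v (i + 1) + 1) * L + v (i + 1) * w) :
    Tendsto (fun i => ℓ i / v i) atTop (nhds (L *
      ((2 * (n + 1 + (m - 1) * edgeDensity n m) - (m * edgeDensity n m + 2 * n)) / (m - 1) -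
        (m * edgeDensity n m + 2 * n - (n + 1 + (m - 1) * edgeDensity n m)) / n) +
      (m * edgeDensity n m + 2 * n - (n + 1 + (m - 1) * edgeDensity n m)) / n * w)) := by
  have hn0 : 0 < n := by linarith
  have hu : 0 < m - 1 := by linarith
  have hpow := pow_le_vertices hn0 hm v0 e0 hv he
  have hpos : ∀ i, 0 < v i := fun i => lt_of_lt_of_le (by positivity) (hpow i).1
  -- Telescoping: by the recurrences, (e - v)/n increases by v and (2v - e)/(m-1) increases by e at
  -- each step; the summand 1 yields `L * i`, and the constant matches `i = 0`.
  have hclosed : ∀ i, ℓ i = L * ((2 * v (i + 1) - e (i + 1)) / (m - 1) -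
      (e (i + 1) - v (i + 1)) / n) + (e (i + 1) - v (i + 1)) / n * w +
      (L * i + (L * (1 - 2 / (m - 1) - 1 / n) + w / n)) := by
    intro i
    induction i with
    | zero =>
      rw [ℓ0, hv, he, v0, e0]
      field_simp
      push_cast
      ring
    | succ i ih =>
      rw [hℓ, ih, hv (i + 1), he (i + 1)]
      push_cast
      field_simp
      ring
  have hle : ∀ i, (2 : ℝ) ^ i ≤ v i := fun i =>
    (pow_le_pow_left₀ (by norm_num) (by linarith) i).trans (hpow i).1
  have hpowdiv : ∀ k : ℕ, Tendsto (fun i : ℕ => (i : ℝ) ^ k / v i) atTop (nhds 0) := fun k =>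
    squeeze_zero (fun i => div_nonneg (by positivity) (hpos i).le)
      (fun i => div_le_div_of_nonneg_left (by positivity) (by positivity) (hle i))
      (tendsto_pow_const_div_const_pow_of_one_lt k (by norm_num : (1 : ℝ) < 2))
  have hρ := tendsto_edges_div_vertices hn hm v0 e0 hv he
  have hlam := (hρ.const_mul (m - 1)).const_add (n + 1)
  have hkap := (hρ.const_mul m).add_const (2 * n)
  have hmain := (((((hlam.const_mul 2).sub hkap).div_const (m - 1)).sub
    ((hkap.sub hlam).div_const n)).const_mul L).add (((hkap.sub hlam).div_const n).mul_const w)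
  have hrest := ((hpowdiv 1).const_mul L).add
    ((hpowdiv 0).const_mul (L * (1 - 2 / (m - 1) - 1 / n) + w / n))
  have := hmain.add hrest
  rw [mul_zero, mul_zero, add_zero, add_zero] at this
  refine this.congr fun i => ?_
  rw [hclosed, hv, he]
  have := hpos i
  field_simp

end Asymptotics

/-! ### Recurrences for the fractal and the conclusion -/

section Fractal

variable {n m : ℕ} {r : Fin n ⊕ Unit}

theorem fractal_finite_connected (hm : 2 ≤ m) (i : ℕ) :
    Finite (fractal n m r i).1 ∧ (fractal n m r i).2.Connected := by
  induction i with
  | zero => exact ⟨inferInstanceAs (Finite (Fin n ⊕ Unit)), wheel_connected n⟩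
  | succ i ih =>
    obtain ⟨_, hc⟩ := ih
    exact ⟨inferInstanceAs (Finite (SubdivVertex m (fractal n m r i).2 ⊕
      ((fractal n m r i).1 × {u // u ≠ r}))),
      attach_connected _ r (subdivide_connected hm hc) (wheel_connected n)⟩

theorem card_ne_root : Nat.card {u : Fin n ⊕ Unit // u ≠ r} = n := by
  rw [Nat.card_eq_fintype_card, Fintype.card_subtype_compl]
  simp

/-- The number of edges, with the same shift of the index as for `vertexCount`. -/
noncomputable def edgeCount (n m : ℕ) (r : Fin n ⊕ Unit) : ℕ → ℕ
  | 0 => 0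
  | i + 1 => Nat.card (fractal n m r i).2.edgeSet

theorem vertexCount_succ (hm : 2 ≤ m) (i : ℕ) : vertexCount n m r (i + 1) =
    -- At `i = 0` the recurrence reads the wheel as attached to a single point without edges,
    -- consistent with the shifted initial values.
    (n + 1) * vertexCount n m r i + (m - 1) * edgeCount n m r i := by
  cases i with
  | zero =>
    change Nat.card (Fin n ⊕ Unit) = (n + 1) * 1 + (m - 1) * 0
    simp
  | succ i =>
    have := (fractal_finite_connected (n := n) (r := r) hm i).1
    change Nat.card (((fractal n m r i).1 ⊕ ((fractal n m r i).2.edgeSet × Fin (m - 1))) ⊕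
      ((fractal n m r i).1 × {u // u ≠ r})) = (n + 1) * Nat.card (fractal n m r i).1 +
        (m - 1) * Nat.card (fractal n m r i).2.edgeSet
    rw [Nat.card_sum, Nat.card_sum, Nat.card_prod, Nat.card_prod, Nat.card_fin, card_ne_root]
    ring

theorem edgeCount_succ (hn : 3 ≤ n) (hm : 2 ≤ m) (i : ℕ) : edgeCount n m r (i + 1) =
    m * edgeCount n m r i + 2 * n * vertexCount n m r i := by
  cases i with
  | zero =>
    change Nat.card (wheel n).edgeSet = m * 0 + 2 * n * 1
    rw [card_edgeSet_wheel n hn]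
    ring
  | succ i =>
    have := (fractal_finite_connected (n := n) (r := r) hm i).1
    change Nat.card (attach (subdivide m (fractal n m r i).2) Sum.inl (wheel n) r).edgeSet =
      m * Nat.card (fractal n m r i).2.edgeSet + 2 * n * Nat.card (fractal n m r i).1
    rw [card_edgeSet_attach, card_edgeSet_subdivide hm, card_edgeSet_wheel n hn]
    ring

theorem numSpanningTrees_fractal_succ (hm : 2 ≤ m) (i : ℕ) :
    numSpanningTrees (fractal n m r (i + 1)).2 =
      m ^ (edgeCount n m r (i + 1) + 1 - vertexCount n m r (i + 1)) *
        numSpanningTrees (fractal n m r i).2 *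
        numSpanningTrees (wheel n) ^ vertexCount n m r (i + 1) := by
  have := (fractal_finite_connected (n := n) (r := r) hm i).1
  change numSpanningTrees (attach (subdivide m (fractal n m r i).2) Sum.inl (wheel n) r) = _
  rw [numSpanningTrees_attach, numSpanningTrees_subdivide hm]
  rfl

theorem vertexCount_le (hm : 2 ≤ m) (i : ℕ) :
    vertexCount n m r (i + 1) ≤ edgeCount n m r (i + 1) + 1 :=
  (fractal_finite_connected (n := n) (r := r) hm i).2.card_vert_le_card_edgeSet_add_one

theorem numSpanningTrees_pos {V : Type} [Finite V] {G : SimpleGraph V} (hG : G.Connected) :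
    0 < numSpanningTrees G := by
  obtain ⟨T, hT, ht⟩ := hG.exists_isTree_le
  exact (Set.ncard_pos (Set.toFinite _)).2 ⟨T, hT, ht⟩

theorem log_numSpanningTrees_fractal_succ (hm : 2 ≤ m) (i : ℕ) :
    Real.log (numSpanningTrees (fractal n m r (i + 1)).2) =
      Real.log (numSpanningTrees (fractal n m r i).2) +
      ((edgeCount n m r (i + 1) : ℝ) - vertexCount n m r (i + 1) + 1) * Real.log m +
      vertexCount n m r (i + 1) * Real.log (numSpanningTrees (wheel n)) := by
  have hfin := fractal_finite_connected (n := n) (r := r) hm i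
  have := hfin.1
  have h1 : (numSpanningTrees (fractal n m r i).2 : ℝ) ≠ 0 := by
    exact_mod_cast (numSpanningTrees_pos hfin.2).ne'
  have h2 : (numSpanningTrees (wheel n) : ℝ) ≠ 0 := by
    exact_mod_cast (numSpanningTrees_pos (wheel_connected n)).ne'
  have h3 : (m : ℝ) ≠ 0 := by
    exact_mod_cast (show m ≠ 0 by omega)
  rw [numSpanningTrees_fractal_succ hm]
  push_cast
  rw [Real.log_mul (by positivity) (by positivity), Real.log_mul (by positivity) h1,
    Real.log_pow, Real.log_pow, Nat.cast_sub (vertexCount_le hm i)]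
  push_cast
  ring

end Fractal

end WheelFractal

theorem mainTheorem4 (n m : ℕ) (hn : 3 ≤ n) (hm : 2 ≤ m) (r : Fin n ⊕ Unit) :
    Filter.Tendsto
      (fun i : ℕ =>
        Real.log (WheelFractal.numSpanningTrees (WheelFractal.fractal n m r i).2) /
          (WheelFractal.vertexCount n m r i : ℝ))
      Filter.atTop
      (nhds (WheelFractal.coeffA n m *
        (WheelFractal.coeffB n m + WheelFractal.coeffC n m))) := by
  have hn' : (3 : ℝ) ≤ n := by exact_mod_cast hn
  have hm' : (2 : ℝ) ≤ m := by exact_mod_cast hm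
  have h := WheelFractal.tendsto_log_div_vertices (n := n) (m := m)
    (v := fun i => WheelFractal.vertexCount n m r i)
    (e := fun i => WheelFractal.edgeCount n m r i)
    (ℓ := fun i => Real.log (WheelFractal.numSpanningTrees (WheelFractal.fractal n m r i).2))
    (L := Real.log m) (w := Real.log (WheelFractal.numSpanningTrees (WheelFractal.wheel n)))
    (by linarith) (by linarith) (by simp [WheelFractal.vertexCount])
    (by simp [WheelFractal.edgeCount])
    (fun i => by
      rw [WheelFractal.vertexCount_succ hm]
      push_cast [Nat.cast_sub (show 1 ≤ m by omega)]
      ring)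
    (fun i => by
      rw [WheelFractal.edgeCount_succ hn hm]
      push_cast
      ring)
    rfl (fun i => WheelFractal.log_numSpanningTrees_fractal_succ hm i)
  convert h using 2
  rw [mul_add, WheelFractal.coeffA_mul_coeffB (by linarith) (by linarith), WheelFractal.coeffC,
    ← mul_assoc, WheelFractal.coeffA_mul_coeffC_factor (by linarith) (by linarith),
    WheelFractal.numSpanningTrees_wheel n hn]
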